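/- **Theorem.** Let $R$ be a commutative noetherian ring and $G$ a finite group. A *permutation $RG$-module* is an $RG$-module isomorphic to the free $R$-module $R(A)$ on some finite left $G$-set $A$, with $G$ permuting the basis $A$. Let $\mathrm{perm}(G;R)$ be the full subcategory of permutation modules in the abelian category $\mathrm{mod}(RG)$ of finitely generated $RG$-modules, let $\mathrm{K}^b(\mathrm{perm}(G;R))$ be its bounded homotopy category and $\mathrm{K}^b_{ac}(\mathrm{perm}(G;R))$ the full subcategory of complexes that are acyclic as complexes of $RG$-modules. Write $\mathrm{D}^b(RG)=\mathrm{D}^b(\mathrm{mod}(RG))$, $\Sigma$ for the suspension, and $(-)^\natural$ for idempotent completion (Karoubi envelope); the idempotent completion of a triangulated category is triangulated by declaring the direct summands of distinguished triangles to be distinguished. Since $\mathrm{D}^b(RG)$ is idempotent complete, the canonical functor $\mathrm{K}^b(\mathrm{perm}(G;R))\to \mathrm{D}^b(RG)$ induces a canonical functor $$\bar\Upsilon\colon\left(\frac{\mathrm{K}^b(\mathrm{perm}(G;R))}{\mathrm{K}^b_{ac}(\mathrm{perm}(G;R))}\right)^{\natural}\longrightarrow \mathrm{D}^b(RG)$$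 on the idempotent completion of the Verdier quotient. For $m\in\mathbb{Z}$, an *$m$-free permutation resolution* of a bounded complex $X$ of finitely generated $RG$-modules is a quasi-isomorphism of complexes $P\to X$, where $P$ is a bounded complex of permutation $RG$-modules such that $P_i$ is a free $RG$-module for all $i\le m$ (homological indexing). Let $\mathcal{A}(G;R)$ be the full subcategory of $\mathrm{D}^b(RG)$ of those objects isomorphic to a bounded complex that admits $m$-free permutation resolutions for all $m\ge 0$, and let $$\mathcal{A}(G;R)^\natural=\{X\in \mathrm{D}^b(RG) \mid X\oplus\Sigma X\in\mathcal{A}(G;R)\}.$$ Then $\mathcal{A}(G;R)^\natural$ is a triangulated subcategory of $\mathrm{D}^b(RG)$ and consists exactly of the direct summands in $\mathrm{D}^b(RG)$ of objects of $\mathcal{A}(G;R)$; in particular it is thick. The functor $\bar\Upsilon$ is exact (it sends distinguished triangles to distinguished triangles) and fully faithful, and its essential image is $\mathcal{A}(G;R)^\natural$. So $\bar\Upsilon$ restricts to an exact equivalence from the idempotent completion of $\mathrm{K}^b(\mathrm{perm}(G;R))/\mathrm{K}^b_{ac}(\mathrm{perm}(G;R))$ to $\mathcal{A}(G;R)^\natural$.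 -/

import Mathlib

open CategoryTheory Category Limits Pretriangulated Triangulated
open scoped ZeroObject

universe w v u

noncomputable section

section
variable {C : Type*} [Category C]

/-- Every idempotent endomorphism of the object `X` splits. -/
def IdempotentsSplit : ObjectProperty C := fun X =>
  ∀ p : X ⟶ X, p ≫ p = p → ∃ (Y : C) (i : Y ⟶ X) (e : X ⟶ Y), i ≫ e = 𝟙 Y ∧ e ≫ i = p

variable [Preadditive C]

theorem exists_splitting_of_sub_sq {X Y : C} (p : X ⟶ X) (hp : p ≫ p = p)
    (i : Y ⟶ X) (e : X ⟶ Y) (hie : i ≫ e = 𝟙 Y) (h : (p - e ≫ i) ≫ (p - e ≫ i) = 0) :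
    ∃ (Y : C) (i : Y ⟶ X) (e : X ⟶ Y), i ≫ e = 𝟙 Y ∧ e ≫ i = p := by
  have hie' : ∀ {Z : C} (f : Y ⟶ Z), i ≫ e ≫ f = f := fun f => by
    rw [← assoc, hie, id_comp]
  have h1 : p - p ≫ e ≫ i - e ≫ i ≫ p + e ≫ i = 0 := by
    rw [← h]
    simp only [Preadditive.sub_comp, Preadditive.comp_sub, hp, assoc, hie']
    abel
  refine ⟨Y, i ≫ p, p ≫ e, ?_, ?_⟩
  · have h2 := congr(i ≫ $h1 ≫ e)
    simp only [Preadditive.sub_comp, Preadditive.comp_sub, Preadditive.add_comp,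
      Preadditive.comp_add, assoc, hie', hie, comp_id, zero_comp, comp_zero] at h2
    rw [assoc, ← assoc p p, hp]
    rw [← sub_eq_zero, ← neg_eq_zero, ← h2]
    abel
  · have h2 := congr(p ≫ $h1)
    simp only [Preadditive.comp_sub, Preadditive.comp_add, comp_zero, ← assoc, hp] at h2
    simp only [assoc] at h2 ⊢
    rw [← sub_eq_zero, ← neg_eq_zero, ← h2]
    abel

variable [HasZeroObject C] [HasShift C ℤ]
  [∀ (n : ℤ), (shiftFunctor C n).Additive] [Pretriangulated C]

theorem exists_splitting_of_triangle (T : Triangle C) (hT : T ∈ distTriang C) (f : T ⟶ T)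
    (h₁ : f.hom₁ ≫ f.hom₁ = f.hom₁) (h₂ : f.hom₂ ≫ f.hom₂ = f.hom₂)
    (h₃ : f.hom₃ ≫ f.hom₃ = f.hom₃)
    (s₁ : IdempotentsSplit T.obj₁) (s₃ : IdempotentsSplit T.obj₃) :
    ∃ (Y : C) (i : Y ⟶ T.obj₂) (e : T.obj₂ ⟶ Y), i ≫ e = 𝟙 Y ∧ e ≫ i = f.hom₂ := by
  obtain ⟨X₁, i₁, e₁, a₁, b₁⟩ := s₁ _ h₁
  obtain ⟨X₃, i₃, e₃, a₃, b₃⟩ := s₃ _ h₃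
  obtain ⟨X₂, u, v, hS⟩ := distinguished_cocone_triangle₂ (i₃ ≫ T.mor₃ ≫ e₁⟦1⟧')
  have c₃ := f.comm₃
  obtain ⟨α, hα₁, hα₂⟩ : ∃ α : X₂ ⟶ T.obj₂, u ≫ α = i₁ ≫ T.mor₁ ∧ v ≫ i₃ = α ≫ T.mor₂ :=
    complete_distinguished_triangle_morphism₂ _ _ hS hT i₁ i₃ (by
    change (i₃ ≫ T.mor₃ ≫ e₁⟦1⟧') ≫ i₁⟦1⟧' = i₃ ≫ T.mor₃
    rw [assoc, assoc, ← Functor.map_comp, b₁, c₃, ← b₃, assoc, reassoc_of% a₃])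
  obtain ⟨β, hβ₁, hβ₂⟩ : ∃ β : T.obj₂ ⟶ X₂, T.mor₁ ≫ β = e₁ ≫ u ∧ T.mor₂ ≫ e₃ = β ≫ v :=
    complete_distinguished_triangle_morphism₂ _ _ hT hS e₁ e₃ (by
    change T.mor₃ ≫ e₁⟦1⟧' = e₃ ≫ i₃ ≫ T.mor₃ ≫ e₁⟦1⟧'
    rw [reassoc_of% b₃, ← reassoc_of% c₃, ← b₁, ← Functor.map_comp, assoc, a₁, comp_id])
  have : IsIso (α ≫ β) := by
    have q₁ : u ≫ α ≫ β = 𝟙 X₁ ≫ u := by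
      rw [reassoc_of% hα₁, hβ₁, reassoc_of% a₁, id_comp]
    have q₂ : v ≫ 𝟙 X₃ = (α ≫ β) ≫ v := by
      rw [assoc, ← hβ₂, ← reassoc_of% hα₂, a₃]
    have q₃ : (i₃ ≫ T.mor₃ ≫ e₁⟦1⟧') ≫ (𝟙 X₁)⟦1⟧' = 𝟙 X₃ ≫ i₃ ≫ T.mor₃ ≫ e₁⟦1⟧' := by
      simp
    exact isIso₂_of_isIso₁₃
      ({ hom₁ := 𝟙 X₁, hom₂ := α ≫ β, hom₃ := 𝟙 X₃, comm₁ := q₁, comm₂ := q₂, comm₃ := q₃ } :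
        Triangle.mk u v (i₃ ≫ T.mor₃ ≫ e₁⟦1⟧') ⟶ Triangle.mk u v (i₃ ≫ T.mor₃ ≫ e₁⟦1⟧'))
      hS hS (inferInstanceAs (IsIso (𝟙 X₁))) (inferInstanceAs (IsIso (𝟙 X₃)))
  have hu : u ≫ inv (α ≫ β) = u := by
    rw [IsIso.comp_inv_eq, reassoc_of% hα₁, hβ₁, reassoc_of% a₁]
  have hv : inv (α ≫ β) ≫ v = v := by
    rw [IsIso.inv_comp_eq, assoc, ← hβ₂, ← reassoc_of% hα₂, a₃, comp_id]
  refine exists_splitting_of_sub_sq f.hom₂ h₂ (inv (α ≫ β) ≫ α) β (by simp) ?_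
  have z₁ : T.mor₁ ≫ (f.hom₂ - β ≫ inv (α ≫ β) ≫ α) = 0 := by
    rw [Preadditive.comp_sub, f.comm₁, reassoc_of% hβ₁, reassoc_of% hu, hα₁, reassoc_of% b₁,
      sub_self]
  have z₂ : (f.hom₂ - β ≫ inv (α ≫ β) ≫ α) ≫ T.mor₂ = 0 := by
    rw [Preadditive.sub_comp, ← f.comm₂, assoc, assoc, ← hα₂, reassoc_of% hv, ← reassoc_of% hβ₂,
      b₃, sub_self]
  obtain ⟨k, hk⟩ := Triangle.coyoneda_exact₂ T hT _ z₂
  nth_rewrite 1 [hk]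
  rw [assoc, z₁, comp_zero]

theorem idempotentsSplit_of_tStructure [IsTriangulated C] (t : TStructure C)
    (h : ∀ (X : C) (n : ℤ), t.IsGE X n → t.IsLE X n → IdempotentsSplit X) (k : ℕ) :
    ∀ (X : C) (a : ℤ), t.IsGE X a → t.IsLE X (a + k) → IdempotentsSplit X := by
  induction k with
  | zero =>
    intro X a ha hb
    exact h X a ha (by simpa using hb)
  | succ k ih =>
    intro X a ha hb p hp
    have hT := t.triangleLEGE_distinguished (a + k) (a + k + 1) rfl X
    let f := (t.triangleLEGE (a + k) (a + k + 1) rfl).map p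
    have hb' : t.IsLE X (a + k + 1) := by
      convert hb using 1
      push_cast
      ring
    refine exists_splitting_of_triangle _ hT f ?_ ?_ ?_ ?_ ?_
    · simp only [f, ← comp_hom₁, ← CategoryTheory.Functor.map_comp, hp]
    · exact hp
    · simp only [f, ← comp_hom₃, ← CategoryTheory.Functor.map_comp, hp]
    · exact ih _ a (inferInstanceAs (t.IsGE ((t.truncLE (a + k)).obj X) a))
        (inferInstanceAs (t.IsLE ((t.truncLE (a + k)).obj X) (a + k)))
    · exact h _ (a + k + 1) (inferInstanceAs (t.IsGE ((t.truncGE (a + k + 1)).obj X) (a + k + 1)))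
        (inferInstanceAs (t.IsLE ((t.truncGE (a + k + 1)).obj X) (a + k + 1)))
end

section
variable {C : Type u} [Category.{v} C] [Abelian C] [HasDerivedCategory.{w} C]
open DerivedCategory
theorem idempotentsSplit_of_iso {C : Type*} [Category C] {X Y : C} (e : X ≅ Y)
    (h : IdempotentsSplit Y) : IdempotentsSplit X := by
  intro p hp
  obtain ⟨Z, i, r, h₁, h₂⟩ := h (e.inv ≫ p ≫ e.hom) (by simp [reassoc_of% hp])
  exact ⟨Z, i ≫ e.inv, e.hom ≫ r, by simp [h₁], by simp [reassoc_of% h₂]⟩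

theorem idempotentsSplit_singleFunctor (A : C) (n : ℤ) :
    IdempotentsSplit (C := Bounded C)
      ⟨(singleFunctor C n).obj A, ⟨⟨n, inferInstance⟩, ⟨n, inferInstance⟩⟩⟩ := by
  intro p hp
  obtain ⟨q, hq⟩ := (singleFunctor C n).map_surjective p.hom
  have hq' : q ≫ q = q := (singleFunctor C n).map_injective (by
    rw [Functor.map_comp, hq]
    exact congr(($hp).hom))
  obtain ⟨B, i, e, h₁, h₂⟩ := IsIdempotentComplete.idempotents_split A q hq'
  refine ⟨⟨(singleFunctor C n).obj B, ⟨⟨n, inferInstance⟩, ⟨n, inferInstance⟩⟩⟩,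
    ObjectProperty.homMk ((singleFunctor C n).map i),
    ObjectProperty.homMk ((singleFunctor C n).map e), ?_, ?_⟩
  · ext
    dsimp
    rw [← Functor.map_comp, h₁, CategoryTheory.Functor.map_id]
  · ext
    dsimp
    rw [← Functor.map_comp, h₂, hq]

instance : IsIdempotentComplete (Bounded C) where
  idempotents_split X := by
    obtain ⟨⟨a, ha⟩, ⟨b, hb⟩⟩ := X.property
    refine idempotentsSplit_of_tStructure (TStructure.onBounded (DerivedCategory.TStructure.t (C := C)))
      (fun Y n h₁ h₂ => ?_) (b - a).toNat X a ?_ ?_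
    · rw [ObjectProperty.tStructure_isGE_iff] at h₁
      rw [ObjectProperty.tStructure_isLE_iff] at h₂
      obtain ⟨A, ⟨e⟩⟩ := exists_iso_singleFunctor_obj_of_isGE_of_isLE Y.obj n
      exact idempotentsSplit_of_iso (ObjectProperty.isoMk _ e) (idempotentsSplit_singleFunctor A n)
    · rwa [ObjectProperty.tStructure_isGE_iff]
    · rw [ObjectProperty.tStructure_isLE_iff]
      exact TStructure.isLE_of_le _ _ b _ (by lia)
end


section
open Idempotents

instance {C D : Type*} [Category C] [Category D] :
    ((Functor.whiskeringLeft C (Karoubi C) D).obj (toKaroubi C)).Full :=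
  whiskeringLeftObjToKaroubiFullyFaithful.full

instance {C D : Type*} [Category C] [Category D] :
    ((Functor.whiskeringLeft C (Karoubi C) D).obj (toKaroubi C)).Faithful :=
  whiskeringLeftObjToKaroubiFullyFaithful.faithful

variable (C : Type*) [Category C] [HasShift C ℤ]

/-- The shift on the idempotent completion: `(X, p)⟦n⟧ = (X⟦n⟧, p⟦n⟧)`. -/
instance karoubiHasShift : HasShift (Karoubi C) ℤ :=
  HasShift.induced (toKaroubi C) ℤ (fun n => (functorExtension₂ C C).obj (shiftFunctor C n))
    (fun n => (functorExtension₂CompWhiskeringLeftToKaroubiIso C C).app (shiftFunctor C n))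

/-- The embedding `C ⥤ Karoubi C` commutes with the shifts. -/
instance toKaroubiCommShift : (toKaroubi C).CommShift ℤ :=
  Functor.CommShift.ofInduced (toKaroubi C) ℤ
    (fun n => (functorExtension₂ C C).obj (shiftFunctor C n))
    (fun n => (functorExtension₂CompWhiskeringLeftToKaroubiIso C C).app (shiftFunctor C n))

end

theorem nat_iso_ext_of_extension {C D E : Type*} [Category C] [Category D] [Category E]
    (L : C ⥤ D) [((Functor.whiskeringLeft C D E).obj L).Faithful] {G H : D ⥤ E} {α β : G ≅ H}
    (h : ∀ X : C, α.hom.app (L.obj X) = β.hom.app (L.obj X)) : α = β := by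
  ext1
  apply ((Functor.whiskeringLeft C D E).obj L).map_injective
  ext X
  exact h X

section
variable {C D E : Type*} [Category C] [Category D] [Category E] (L : C ⥤ D) (F : C ⥤ E)
  (F' : D ⥤ E) (e : L ⋙ F' ≅ F)
  [HasShift C ℤ] [HasShift D ℤ] [HasShift E ℤ] [L.CommShift ℤ] [F.CommShift ℤ]
  [((Functor.whiskeringLeft C D E).obj L).Full] [((Functor.whiskeringLeft C D E).obj L).Faithful]

/-- The extension of the isomorphism `F.commShiftIso a` along `L`. -/
def extensionShiftIso (a : ℤ) : shiftFunctor D a ⋙ F' ≅ F' ⋙ shiftFunctor E a :=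
  ((Functor.whiskeringLeft C D E).obj L).preimageIso
    ((Functor.associator _ _ _).symm ≪≫
        Functor.isoWhiskerRight (L.commShiftIso a).symm F' ≪≫
        Functor.associator _ _ _ ≪≫
        Functor.isoWhiskerLeft _ e ≪≫
        F.commShiftIso a ≪≫
        Functor.isoWhiskerRight e.symm _ ≪≫ Functor.associator _ _ _)

theorem extensionShiftIso_hom_app (a : ℤ) (X : C) :
    (extensionShiftIso L F F' e a).hom.app (L.obj X) =
      F'.map ((L.commShiftIso a).inv.app X) ≫ e.hom.app (X⟦a⟧) ≫
        (F.commShiftIso a).hom.app X ≫ (e.inv.app X)⟦a⟧' := by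
  have h : Functor.whiskerLeft L (extensionShiftIso L F F' e a).hom = _ :=
    ((Functor.whiskeringLeft C D E).obj L).map_preimage _
  exact (NatTrans.congr_app h X).trans (by simp)

/-- If `L ⋙ F' ≅ F` and precomposition with `L` is fully faithful, then the compatibility of `F`
with the shifts extends to `F'`. -/
@[reducible]
def extensionCommShift : F'.CommShift ℤ where
  commShiftIso := extensionShiftIso L F F' e
  commShiftIso_zero := by
    apply nat_iso_ext_of_extension L
    intro X
    rw [extensionShiftIso_hom_app]
    simp only [Functor.commShiftIso_zero, Functor.CommShift.isoZero_inv_app,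
      Functor.CommShift.isoZero_hom_app, Functor.map_comp, assoc]
    have h₁ := e.hom.naturality ((shiftFunctorZero C ℤ).hom.app X)
    have h₂ := (shiftFunctorZero E ℤ).inv.naturality (e.inv.app X)
    simp only [Functor.comp_map, Functor.id_map, Functor.id_obj] at h₁ h₂
    have r : F'.map (L.map ((shiftFunctorZero C ℤ).inv.app X)) ≫
        F'.map (L.map ((shiftFunctorZero C ℤ).hom.app X)) = 𝟙 (F'.obj (L.obj X)) := by
      rw [← F'.map_comp, ← L.map_comp, Iso.inv_hom_id_app]
      simp
    have r' : e.hom.app X ≫ e.inv.app X = 𝟙 (F'.obj (L.obj X)) := e.hom_inv_id_app X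
    rw [← reassoc_of% h₁, reassoc_of% r, ← h₂, reassoc_of% r']
    rfl
  commShiftIso_add a b := by
    apply nat_iso_ext_of_extension L
    intro X
    rw [extensionShiftIso_hom_app]
    have h₁ := e.hom.naturality ((shiftFunctorAdd C a b).hom.app X)
    have h₂ := (shiftFunctorAdd E a b).inv.naturality (e.inv.app X)
    have h₃ := (extensionShiftIso L F F' e b).hom.naturality ((L.commShiftIso a).inv.app X)
    have h₄ := extensionShiftIso_hom_app L F F' e b (X⟦a⟧)
    simp only [Functor.comp_map, Functor.comp_obj] at h₁ h₂ h₃ h₄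
    simp only [Functor.commShiftIso_add, Functor.CommShift.isoAdd_inv_app,
      Functor.CommShift.isoAdd_hom_app, Functor.map_comp, assoc]
    congr 1
    have r : F'.map (L.map ((shiftFunctorAdd C a b).inv.app X)) ≫
        F'.map (L.map ((shiftFunctorAdd C a b).hom.app X)) = 𝟙 (F'.obj (L.obj (X⟦a⟧⟦b⟧))) := by
      rw [← F'.map_comp, ← L.map_comp, Iso.inv_hom_id_app]
      simp
    have r' : e.inv.app (X⟦a⟧) ≫ e.hom.app (X⟦a⟧) = 𝟙 (F.obj (X⟦a⟧)) := e.inv_hom_id_app _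
    have r'' := congr((shiftFunctor E b).map $r')
    simp only [Functor.map_comp, CategoryTheory.Functor.map_id] at r''
    rw [← reassoc_of% h₁, reassoc_of% r, extensionShiftIso_hom_app, Functor.map_comp,
      Functor.map_comp, Functor.map_comp, assoc, assoc, assoc, ← reassoc_of% h₃, h₄]
    simp only [assoc]
    rw [reassoc_of% r'', ← h₂]
end


section
variable (C : Type*) [Category C] [Preadditive C]

/-- Bounded cochain complexes. -/
def boundedComplex : ObjectProperty (CochainComplex C ℤ) :=
  fun K => (∃ a : ℤ, K.IsStrictlyGE a) ∧ ∃ b : ℤ, K.IsStrictlyLE b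

/-- Bounded complexes, as objects of the homotopy category. -/
def boundedHomotopy : ObjectProperty (HomotopyCategory C (.up ℤ)) :=
  (boundedComplex C).strictMap (HomotopyCategory.quotient _ _)

variable {C} in
theorem boundedHomotopy_quotient_iff (K : CochainComplex C ℤ) :
    boundedHomotopy C ((HomotopyCategory.quotient _ _).obj K) ↔ boundedComplex C K := by
  refine ⟨?_, fun h ↦ ⟨_, h⟩⟩
  simp only [boundedHomotopy, ObjectProperty.strictMap_iff]
  rintro ⟨L, h, hL⟩
  obtain rfl : L = K := congr_arg Quotient.as hL
  exact h

instance [HasZeroObject C] : (boundedHomotopy C).ContainsZero where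
  exists_zero :=
    ⟨(HomotopyCategory.quotient _ _).obj 0, Functor.map_isZero _ (isZero_zero _), by
      rw [boundedHomotopy_quotient_iff]
      exact ⟨⟨0, inferInstance⟩, ⟨0, inferInstance⟩⟩⟩

instance : (boundedHomotopy C).IsStableUnderShift ℤ where
  isStableUnderShiftBy n :=
    { le_shift K hK := by
        obtain ⟨K : CochainComplex _ _, rfl⟩ := K.quotient_obj_surjective
        rw [boundedHomotopy_quotient_iff] at hK
        obtain ⟨⟨a, _⟩, ⟨b, _⟩⟩ := hK
        rw [ObjectProperty.prop_shift_iff, HomotopyCategory.shift_quotient_obj,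
          boundedHomotopy_quotient_iff]
        exact ⟨⟨a - n, K.isStrictlyGE_shift a n (a - n) (by lia)⟩,
          ⟨b - n, K.isStrictlyLE_shift b n (b - n) (by lia)⟩⟩ }

theorem boundedComplex_mappingCone [HasBinaryBiproducts C] {K L : CochainComplex C ℤ} (f : K ⟶ L)
    (hK : boundedComplex C K) (hL : boundedComplex C L) :
    boundedComplex C (CochainComplex.mappingCone f) := by
  obtain ⟨⟨a, _⟩, ⟨b, _⟩⟩ := hK
  obtain ⟨⟨a', _⟩, ⟨b', _⟩⟩ := hL
  refine ⟨⟨min (a - 1) a', CochainComplex.isStrictlyGE_mappingCone f a a' _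
    (by simp) (by simp)⟩, ⟨max b b', ?_⟩⟩
  rw [CochainComplex.isStrictlyLE_iff]
  intro i hi
  simp only [CochainComplex.mappingCone.isZero_X_iff]
  exact ⟨K.isZero_of_isStrictlyLE b _ (by lia), L.isZero_of_isStrictlyLE b' _ (by lia)⟩

instance [HasZeroObject C] [HasBinaryBiproducts C] :
    (boundedHomotopy C).IsTriangulatedClosed₃ where
  ext₃' T hT h₁ h₂ := by
    have h₁' : boundedComplex C T.obj₁.as := by
      rwa [← boundedHomotopy_quotient_iff]
    have h₂' : boundedComplex C T.obj₂.as := by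
      rwa [← boundedHomotopy_quotient_iff]
    obtain ⟨f : T.obj₁.as ⟶ T.obj₂.as, hf⟩ :=
      (HomotopyCategory.quotient _ _).map_surjective T.mor₁
    refine ⟨_, ?_,
      ⟨Triangle.π₃.mapIso (isoTriangleOfIso₁₂ T _ hT
        (HomotopyCategory.mappingCone_triangleh_distinguished f)
        (Iso.refl _) (Iso.refl _) ?_)⟩⟩
    · change boundedHomotopy C ((HomotopyCategory.quotient _ _).obj _)
      rw [boundedHomotopy_quotient_iff]
      exact boundedComplex_mappingCone _ f h₁' h₂'
    · change T.mor₁ ≫ 𝟙 _ = 𝟙 _ ≫ (HomotopyCategory.quotient _ _).map f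
      rw [hf, comp_id]
      exact (id_comp T.mor₁).symm

instance [HasZeroObject C] [HasBinaryBiproducts C] : (boundedHomotopy C).IsTriangulated where
  toIsTriangulatedClosed₂ := .of_isTriangulatedClosed₃

/-- The homotopy category `K^b(C)` of bounded complexes. -/
abbrev Kb := (boundedHomotopy C).FullSubcategory

end

section
variable (R : Type u) [CommRing R] (G : Type v) [Group G]

instance isNoetherianRing_monoidAlgebra [Finite G] [IsNoetherianRing R] :
    IsNoetherianRing (MonoidAlgebra R G) := by
  have : Module.Finite R (MonoidAlgebra R G) :=
    Module.Finite.equiv (MonoidAlgebra.coeffLinearEquiv R).symm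
  exact IsNoetherianRing.of_finite R _

/-- The abelian category of finitely generated `RG`-modules. -/
abbrev FGRep := FGModuleCat.{max u v} (MonoidAlgebra R G)

/-- Permutation modules: the `RG`-modules isomorphic to `R(A)` for some finite `G`-set `A`. -/
def IsPermutationModule (M : Type (max u v)) [AddCommGroup M] [Module (MonoidAlgebra R G) M] :
    Prop :=
  ∃ (A : Type v) (_ : Finite A) (_ : MulAction G A),
    Nonempty (M ≃ₗ[MonoidAlgebra R G] (Representation.ofMulAction R G A).asModule)

/-- The permutation modules, as a property of objects of `FGRep R G`. -/
def permProp : ObjectProperty (FGRep R G) := fun M => IsPermutationModule R G M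


section
variable {R G}

/-- `R(A) × R(B) ≃ R(A ⊔ B)` as `R`-modules. -/
def sumMap (A B : Type v) :
    (MonoidAlgebra R A × MonoidAlgebra R B) ≃ₗ[R] MonoidAlgebra R (A ⊕ B) :=
  ((MonoidAlgebra.coeffLinearEquiv R).prodCongr (MonoidAlgebra.coeffLinearEquiv R)).trans
    ((Finsupp.sumFinsuppLEquivProdFinsupp R).symm.trans (MonoidAlgebra.coeffLinearEquiv R).symm)

theorem sumMap_smul (A B : Type v) [MulAction G A] [MulAction G B] (g : G)
    (x : MonoidAlgebra R A) (y : MonoidAlgebra R B) :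
    sumMap A B (Representation.ofMulAction R G A g x, Representation.ofMulAction R G B g y) =
      Representation.ofMulAction R G (A ⊕ B) g (sumMap A B (x, y)) := by
  ext (a | b) <;> simp [sumMap, Representation.coeff_ofMulAction]


/-- The additive isomorphism `sumMap`, between the underlying modules of the representations. -/
def sumAddEquiv (A B : Type v) [MulAction G A] [MulAction G B] :
    ((Representation.ofMulAction R G A).asModule × (Representation.ofMulAction R G B).asModule)
      ≃+ (Representation.ofMulAction R G (A ⊕ B)).asModule :=
  (sumMap (R := R) A B).toAddEquiv

theorem sumAddEquiv_smul (A B : Type v) [MulAction G A] [MulAction G B] (r : MonoidAlgebra R G)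
    (x : (Representation.ofMulAction R G A).asModule ×
      (Representation.ofMulAction R G B).asModule) :
    sumAddEquiv A B (r • x) = r • sumAddEquiv A B x := by
  induction r using MonoidAlgebra.induction_linear with
  | zero => rw [zero_smul, zero_smul, map_zero]
  | add a b ha hb => rw [add_smul, add_smul, map_add, ha, hb]
  | single g c =>
    obtain ⟨x, y⟩ := x
    rw [Representation.single_smul]
    have h : (MonoidAlgebra.single g c • (x, y) : (Representation.ofMulAction R G A).asModule ×
        (Representation.ofMulAction R G B).asModule) =
        (MonoidAlgebra.single g c • x, MonoidAlgebra.single g c • y) := rfl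
    rw [h, Representation.single_smul, Representation.single_smul]
    exact ((sumMap (R := R) A B).map_smul c
      (Representation.ofMulAction R G A g x, Representation.ofMulAction R G B g y)).trans
      (congrArg (c • ·) (sumMap_smul A B g x y))

/-- `R(A) × R(B)` is isomorphic to `R(A ⊔ B)`. -/
def sumEquiv (A B : Type v) [MulAction G A] [MulAction G B] :
    ((Representation.ofMulAction R G A).asModule × (Representation.ofMulAction R G B).asModule)
      ≃ₗ[MonoidAlgebra R G] (Representation.ofMulAction R G (A ⊕ B)).asModule :=
  { sumAddEquiv A B with map_smul' := sumAddEquiv_smul A B }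

theorem IsPermutationModule.prod {M N : Type (max u v)} [AddCommGroup M] [AddCommGroup N]
    [Module (MonoidAlgebra R G) M] [Module (MonoidAlgebra R G) N]
    (hM : IsPermutationModule R G M) (hN : IsPermutationModule R G N) :
    IsPermutationModule R G (M × N) := by
  obtain ⟨A, _, _, ⟨e⟩⟩ := hM
  obtain ⟨B, _, _, ⟨f⟩⟩ := hN
  exact ⟨A ⊕ B, inferInstance, inferInstance, ⟨(e.prodCongr f).trans (sumEquiv A B)⟩⟩

theorem isPermutationModule_punit : IsPermutationModule R G PUnit.{max u v + 1} := by
  let _ : MulAction G PEmpty.{v + 1} :=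
    { smul := fun _ x => x, one_smul := fun x => x.elim, mul_smul := fun _ _ x => x.elim }
  have : Subsingleton (Representation.ofMulAction R G PEmpty.{v + 1}).asModule :=
    (MonoidAlgebra.coeffLinearEquiv (S := R) (M := PEmpty.{v + 1}) R).toEquiv.subsingleton
  exact ⟨PEmpty, inferInstance, inferInstance, ⟨LinearEquiv.ofSubsingleton _ _⟩⟩

end

/-- The additive category `perm(G;R)` of permutation modules. -/
abbrev Perm := (permProp R G).FullSubcategory

instance : HasZeroObject (Perm R G) where
  zero := ⟨⟨FGModuleCat.of (MonoidAlgebra R G) PUnit, isPermutationModule_punit⟩, by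
    rw [IsZero.iff_id_eq_zero]
    ext x⟩

instance : HasBinaryBiproducts (Perm R G) where
  has_binary_biproduct M N := HasBinaryBiproduct.mk
    { bicone :=
        { pt := ⟨FGModuleCat.of (MonoidAlgebra R G) (M.obj × N.obj),
            IsPermutationModule.prod M.property N.property⟩
          fst := ObjectProperty.homMk (FGModuleCat.ofHom (LinearMap.fst (MonoidAlgebra R G) M.obj N.obj))
          snd := ObjectProperty.homMk (FGModuleCat.ofHom (LinearMap.snd (MonoidAlgebra R G) M.obj N.obj))
          inl := ObjectProperty.homMk (FGModuleCat.ofHom (LinearMap.inl (MonoidAlgebra R G) M.obj N.obj))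
          inr := ObjectProperty.homMk (FGModuleCat.ofHom (LinearMap.inr (MonoidAlgebra R G) M.obj N.obj))
          inl_fst := by ext x; rfl
          inl_snd := by ext x; rfl
          inr_fst := by ext x; rfl
          inr_snd := by ext x; rfl }
      isBilimit := isBinaryBilimitOfTotal _ (by
        refine ObjectProperty.hom_ext _ (ObjectProperty.hom_ext _ (ModuleCat.hom_ext
          (LinearMap.ext fun x => ?_)))
        exact Prod.ext (add_zero (Prod.fst x)) (zero_add (Prod.snd x))) }

variable [Finite G] [IsNoetherianRing R]

/-- The functor `K^b(perm(G;R)) ⥤ K(mod(RG))`. -/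
def inclK : Kb (Perm R G) ⥤ HomotopyCategory (FGRep R G) (.up ℤ) :=
  (boundedHomotopy (Perm R G)).ι ⋙ (permProp R G).ι.mapHomotopyCategory (.up ℤ)

instance : (inclK R G).CommShift ℤ := by
  unfold inclK
  infer_instance

instance : (inclK R G).IsTriangulated := by
  unfold inclK
  infer_instance

/-- `K^b_ac(perm(G;R))`: the bounded complexes of permutation modules that are acyclic as complexes
of `RG`-modules. -/
def Kbac : ObjectProperty (Kb (Perm R G)) :=
  (HomotopyCategory.subcategoryAcyclic (FGRep R G)).inverseImage (inclK R G)

instance : (Kbac R G).IsTriangulated := by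
  unfold Kbac
  infer_instance

/-- The Verdier quotient `K^b(perm(G;R)) / K^b_ac(perm(G;R))`: the localization at the morphisms whose
cone is acyclic. -/
abbrev VerdierQuotient := (Kbac R G).trW.Localization

variable [HasDerivedCategory.{w} (FGRep R G)]

/-- `D^b(RG)`: the bounded derived category of finitely generated `RG`-modules. -/
abbrev Db := DerivedCategory.Bounded (FGRep R G)

variable {R G} in
theorem bounded_Q {C : Type*} [Category C] [Abelian C] [HasDerivedCategory.{w} C]
    (K : CochainComplex C ℤ) (hK : boundedComplex C K) :
    (DerivedCategory.TStructure.t (C := C)).bounded (DerivedCategory.Q.obj K) := by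
  obtain ⟨⟨a, _⟩, ⟨b, _⟩⟩ := hK
  exact ⟨⟨a, inferInstance⟩, ⟨b, inferInstance⟩⟩

theorem bounded_inclK (X : Kb (Perm R G)) :
    (DerivedCategory.TStructure.t (C := FGRep R G)).bounded
      ((inclK R G ⋙ DerivedCategory.Qh).obj X) := by
  obtain ⟨X, hX⟩ := X
  obtain ⟨K, rfl⟩ := HomotopyCategory.quotient_obj_surjective X
  rw [boundedHomotopy_quotient_iff] at hX
  refine ObjectProperty.prop_of_iso _ ((DerivedCategory.quotientCompQhIso (FGRep R G)).symm.app _)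
    (bounded_Q (((permProp R G).ι.mapHomologicalComplex (.up ℤ)).obj K) ?_)
  obtain ⟨⟨a, _⟩, ⟨b, _⟩⟩ := hX
  exact ⟨⟨a, inferInstance⟩, ⟨b, inferInstance⟩⟩

/-- The canonical functor `K^b(perm(G;R)) ⥤ D^b(RG)`. -/
def Upsilon : Kb (Perm R G) ⥤ Db R G :=
  (DerivedCategory.TStructure.t (C := FGRep R G)).bounded.lift
    (inclK R G ⋙ DerivedCategory.Qh) (bounded_inclK R G)

instance : (Upsilon R G).CommShift ℤ := by
  unfold Upsilon
  infer_instance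

theorem Upsilon_inverts : (Kbac R G).trW.IsInvertedBy (Upsilon R G) := by
  intro X Y f hf
  have h := (HomotopyCategory.subcategoryAcyclic (FGRep R G)).inverseImage_trW_isInverted
    (inclK R G) DerivedCategory.Qh f hf
  have : IsIso ((DerivedCategory.Bounded.ι (C := FGRep R G)).map ((Upsilon R G).map f)) := h
  exact isIso_of_reflects_iso _ (DerivedCategory.Bounded.ι (C := FGRep R G))

/-- The functor `K^b(perm(G;R)) / K^b_ac(perm(G;R)) ⥤ D^b(RG)` induced by `Upsilon R G`. -/
def UpsilonQuotient : VerdierQuotient R G ⥤ Db R G :=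
  Localization.lift (Upsilon R G) (Upsilon_inverts R G) (Kbac R G).trW.Q

instance : Localization.Lifting (Kbac R G).trW.Q (Kbac R G).trW (Upsilon R G) (UpsilonQuotient R G) := by
  unfold UpsilonQuotient
  infer_instance

instance : (UpsilonQuotient R G).CommShift ℤ :=
  Functor.commShiftOfLocalization (Kbac R G).trW.Q (Kbac R G).trW ℤ (Upsilon R G) (UpsilonQuotient R G)


open Idempotents

/-- The canonical functor `(K^b(perm(G;R)) / K^b_ac(perm(G;R)))^♮ ⥤ D^b(RG)`: the extension of
`UpsilonQuotient R G` to the idempotent completion, `D^b(RG)` being idempotent complete. -/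
def UpsilonBar : Karoubi (VerdierQuotient R G) ⥤ Db R G :=
  (functorExtension (VerdierQuotient R G) (Db R G)).obj (UpsilonQuotient R G)

/-- `UpsilonBar R G` extends `UpsilonQuotient R G`. -/
def toKaroubiCompUpsilonBarIso :
    toKaroubi (VerdierQuotient R G) ⋙ UpsilonBar R G ≅ UpsilonQuotient R G :=
  Functor.isoWhiskerRight ((functorExtension₂CompWhiskeringLeftToKaroubiIso
      (VerdierQuotient R G) (Db R G)).app (UpsilonQuotient R G))
      (toKaroubiEquivalence (Db R G)).inverse ≪≫
    Functor.isoWhiskerLeft (UpsilonQuotient R G) (toKaroubiEquivalence (Db R G)).unitIso.symm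

instance : (UpsilonBar R G).CommShift ℤ :=
  extensionCommShift (toKaroubi (VerdierQuotient R G)) (UpsilonQuotient R G) (UpsilonBar R G)
    (toKaroubiCompUpsilonBarIso R G)

variable {R G} in
/-- The complex `K` admits an `m`-free permutation resolution: a quasi-isomorphism `P ⟶ K` with `P` a
bounded complex of permutation modules such that `P_i` is free for all `i ≤ m`. In the cohomological
indexing used here, `P_i` is `P.X (-i)`. -/
def HasFreePermResolution (m : ℤ) (K : CochainComplex (FGRep R G) ℤ) : Prop :=
  ∃ P : CochainComplex (FGRep R G) ℤ, boundedComplex _ P ∧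
    (∀ j : ℤ, IsPermutationModule R G (P.X j)) ∧
    (∀ j : ℤ, -m ≤ j → Module.Free (MonoidAlgebra R G) (P.X j)) ∧
    ∃ s : P ⟶ K, QuasiIso s

/-- `A(G;R)`: the objects of `D^b(RG)` represented by a bounded complex that admits `m`-free permutation
resolutions for all `m ≥ 0`. -/
def Acat : ObjectProperty (Db R G) := fun X =>
  ∃ K : CochainComplex (FGRep R G) ℤ, boundedComplex _ K ∧
    Nonempty (DerivedCategory.Q.obj K ≅ X.obj) ∧ ∀ m : ℕ, HasFreePermResolution m K

/-- `A(G;R)^♮`: the objects `X` of `D^b(RG)` such that `X ⊕ ΣX` belongs to `A(G;R)`. -/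
def AcatNat : ObjectProperty (Db R G) := fun X => Acat R G (X ⊞ X⟦(1 : ℤ)⟧)

end

section
open Idempotents
variable (C : Type*) [Category C] [Preadditive C] [HasZeroObject C] [HasShift C ℤ]
  [∀ n : ℤ, (shiftFunctor C n).Additive] [Pretriangulated C]

/-- The distinguished triangles of the idempotent completion of a triangulated category `C`: the direct
summands of (images of) distinguished triangles of `C`. -/
def karoubiDistTriang : Set (Triangle (Karoubi C)) := fun T =>
  ∃ T' ∈ distTriang C, Nonempty (Retract T ((toKaroubi C).mapTriangle.obj T'))
end

end

/-!
The heart of the matter is that *every* bounded complex `Y` of permutation modules has `m`-free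
permutation resolutions for all `m`. This rests on an explicit complex `W` of permutation modules. Its
basis consists of the words whose letters are pairwise disjoint nonempty subsets of `G`, a letter `S`
having degree `2 * #S - 1`, and its differential is the odd derivation that takes a letter `S` to the sum of
the words `A B` over the decompositions of `S` into two nonempty parts, plus `1` if `S` is a singleton. No
signs enter into the action of `G` by translations, so that the terms of `W` are permutation modules, and
there are only finitely many words. The term `W_0` is `R` and the term `W_1 = R(G)` is free. Moreover, `W` is
exact, with a contracting homotopy (not `G`-equivariant) that is defined over the integers
(`WordComplex.d_h_add_h_d`). Tensoring with `Y` gives a finite resolution of `Y` by the complexes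
`W_e ⊗ Y` with `e ≥ 1`, and an iterated mapping cone (`exists_quasiIso_of_resolution`) turns it into a
quasi-isomorphism `L ⟶ Y`, where `L` has one more free term than `Y` (`exists_quasiIso_freePermProp`).
This can be iterated. Hence `A(G;R)` is the essential image of the functor from the Verdier quotient to
the derived category (`Acat_eq_essImage`).

This functor is fully faithful for the following reason. A chain map from a bounded complex whose terms
in degrees `≥ c` are projective to an acyclic complex concentrated in degrees `≥ c` is null-homotopic
(cohomological indexing), so that morphisms from the former to a complex in degrees `> c` are the same in
the homotopy category and in the derived category (`bijective_Qh_map_of_projective`). By the resolutions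
above, the source of any morphism can be replaced by such a complex, for `c` as small as the target
requires. In particular `A(G;R)` is a triangulated subcategory, as the essential image of a fully faithful
exact functor.

The rest is formal. The direct summands of the objects of a triangulated subcategory `A` form a
triangulated subcategory, which consists of the `X` with `X ⊞ X⟦1⟧` in `A`
(`retractClosure_iff_prop_biprod_shift`). The extension of a fully faithful functor to the idempotent
completion is fully faithful, and its essential image consists of the direct summands of the objects in
the essential image (`Karoubi.essImage_eq_retractClosure`). It is exact because the direct summands of
distinguished triangles are distinguished (`distinguished_of_retract`).
-/

noncomputable section

/-! ### Words in the finite subsets of a set -/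

namespace WordComplex

section Words
variable {X : Type*} [DecidableEq X]

/-- The proper nonempty subsets of `S`. -/
def parts (S : Finset X) : Finset (Finset X) := (S.powerset.erase ∅).erase S

theorem mem_parts {S A : Finset X} : A ∈ parts S ↔ A ⊆ S ∧ A ≠ ∅ ∧ A ≠ S := by
  simp only [parts, Finset.mem_erase, Finset.mem_powerset]
  tauto

theorem sdiff_mem_parts {S A : Finset X} (h : A ∈ parts S) : S \ A ∈ parts S := by
  rw [mem_parts] at h ⊢
  obtain ⟨h₁, h₂, h₃⟩ := h
  refine ⟨Finset.sdiff_subset, ?_, ?_⟩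
  · rw [Ne, Finset.sdiff_eq_empty_iff_subset]
    exact fun h => h₃ (h₁.antisymm h)
  · rw [Ne, Finset.sdiff_eq_self_iff_disjoint, disjoint_comm]
    exact fun h => h₂ (Finset.disjoint_self_iff_empty _ |>.1 (h.mono_right h₁))

@[simp]
theorem parts_singleton (a : X) : parts {a} = ∅ := by
  ext A
  simp only [mem_parts, Finset.subset_singleton_iff, Finset.notMem_empty, iff_false]
  tauto

theorem sum_parts_swap {M : Type*} [AddCommGroup M] (S : Finset X)
    (f : Finset X → Finset X → M) :
    ∑ A ∈ parts S, f A (S \ A) = ∑ A ∈ parts S, f (S \ A) A := by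
  refine Finset.sum_bij' (fun A _ => S \ A) (fun A _ => S \ A) (fun A h => sdiff_mem_parts h)
    (fun A h => sdiff_mem_parts h) (fun A h => ?_) (fun A h => ?_) (fun A h => ?_)
  all_goals rw [Finset.sdiff_sdiff_eq_self (mem_parts.1 h).1]

theorem sum_parts {M : Type*} [AddCommGroup M] {S : Finset X} (hS : S.Nonempty)
    (f : Finset X → M) :
    ∑ A ∈ parts S, f A = ∑ A ∈ S.powerset, f A - f ∅ - f S := by
  have h₁ : S ∈ S.powerset.erase ∅ := by simp [hS.ne_empty]
  have h₂ : ∅ ∈ S.powerset := by simp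
  rw [← Finset.add_sum_erase _ _ h₂, ← Finset.add_sum_erase _ _ h₁]
  simp only [parts]
  abel

/-- The decompositions of `insert a S` into two nonempty parts are those with `{a}` as one of the parts
and those obtained from a decomposition of `S` by adding `a` to one of its parts. -/
theorem sum_parts_insert {M : Type*} [AddCommGroup M] {S : Finset X} (hS : S.Nonempty) {a : X}
    (ha : a ∉ S) (f : Finset X → Finset X → M) :
    ∑ A ∈ parts (insert a S), f A (insert a S \ A) =
      f {a} S + f S {a} +
        ∑ A ∈ parts S, (f (insert a A) (S \ A) + f A (insert a (S \ A))) := by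
  have h₁ : ∀ A ∈ S.powerset, f (insert a A) (insert a S \ insert a A) =
      f (insert a A) (S \ A) := by
    intro A hA
    rw [Finset.insert_sdiff_insert, Finset.sdiff_insert_of_notMem ha]
  have h₂ : ∀ A ∈ S.powerset, f A (insert a S \ A) = f A (insert a (S \ A)) := by
    intro A hA
    rw [Finset.insert_sdiff_of_notMem _ (fun h => ha (Finset.mem_powerset.1 hA h))]
  rw [sum_parts (Finset.insert_nonempty a S), sum_parts hS, Finset.sum_powerset_insert ha,
    Finset.sum_congr rfl h₁, Finset.sum_congr rfl h₂, Finset.sum_add_distrib]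
  have h₃ : (insert a S) \ S = {a} := by
    rw [Finset.insert_sdiff_of_notMem _ ha, sdiff_self]; rfl
  simp only [Finset.sdiff_empty, sdiff_self]
  have h₄ : insert a (∅ : Finset X) = {a} := rfl
  simp only [Finset.bot_eq_empty, h₄]
  abel

/-- Integral linear combinations of words, the letters being finite subsets of `X`. -/
abbrev Chains (X : Type*) := List (Finset X) →₀ ℤ

/-- Prepending the letter `S`. -/
def cons (S : Finset X) : Chains X →ₗ[ℤ] Chains X := Finsupp.lmapDomain ℤ ℤ (List.cons S)

theorem cons_single {X : Type*} (S : Finset X) (w : List (Finset X)) :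
    cons S (Finsupp.single w 1) = Finsupp.single (S :: w) 1 := by
  simp [cons]

/-- `c ↦ (d x_S) * c`, where `d x_S = ∑ x_A x_B` over the decompositions of `S` into two nonempty
parts, plus `1` if `S` is a singleton. -/
def dLetter (S : Finset X) : Chains X →ₗ[ℤ] Chains X :=
  ∑ A ∈ parts S, cons A ∘ₗ cons (S \ A) + if S.card = 1 then LinearMap.id else 0

theorem dLetter_apply (S : Finset X) (c : Chains X) :
    dLetter S c = ∑ A ∈ parts S, cons A (cons (S \ A) c) + if S.card = 1 then c else 0 := by
  rw [dLetter]
  split_ifs <;> simp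

/-- The differential of a word. -/
def dWord : List (Finset X) → Chains X
  | [] => 0
  | S :: w => dLetter S (Finsupp.single w 1) - cons S (dWord w)

/-- The differential: the derivation, in the graded sense for which all letters are odd, that
extends `x_S ↦ d x_S`. -/
def d : Chains X →ₗ[ℤ] Chains X := Finsupp.linearCombination ℤ dWord

theorem d_single (w : List (Finset X)) : d (Finsupp.single w 1) = dWord w := by simp [d]

theorem chains_hom_ext {X M : Type*} [AddCommGroup M] {f g : Chains X →ₗ[ℤ] M}
    (h : ∀ w, f (Finsupp.single w 1) = g (Finsupp.single w 1)) : f = g := by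
  ext w
  exact h w

theorem d_cons (S : Finset X) (c : Chains X) : d (cons S c) = dLetter S c - cons S (d c) := by
  suffices h : d ∘ₗ cons S = dLetter S - cons S ∘ₗ d from congr($h c)
  refine chains_hom_ext fun w => ?_
  simp [cons_single, d_single, dWord]

/-- Two ways to enumerate the decompositions of `S` into three nonempty parts. -/
theorem sum_parts_assoc {M : Type*} [AddCommGroup M] (S : Finset X)
    (f : Finset X → Finset X → Finset X → M) :
    ∑ A ∈ parts S, ∑ B ∈ parts A, f B (A \ B) (S \ A) =
      ∑ A ∈ parts S, ∑ B ∈ parts (S \ A), f A B ((S \ A) \ B) := by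
  rw [Finset.sum_sigma', Finset.sum_sigma']
  refine Finset.sum_bij' (fun x _ => ⟨x.2, x.1 \ x.2⟩) (fun x _ => ⟨x.1 ∪ x.2, x.1⟩) ?_ ?_ ?_ ?_ ?_
  · rintro ⟨A, B⟩ h
    simp only [Finset.mem_sigma, mem_parts] at h ⊢
    obtain ⟨⟨h₁, h₂, h₃⟩, h₄, h₅, h₆⟩ := h
    refine ⟨⟨h₄.trans h₁, h₅, ?_⟩, Finset.sdiff_subset_sdiff h₁ subset_rfl, ?_, ?_⟩
    · rintro rfl
      exact h₃ (h₁.antisymm h₄)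
    · rw [Ne, Finset.sdiff_eq_empty_iff_subset]
      exact fun h => h₆ (h₄.antisymm h)
    · intro h
      apply h₃
      rw [← Finset.union_sdiff_of_subset h₄, h, Finset.union_sdiff_of_subset (h₄.trans h₁)]
  · rintro ⟨A, B⟩ h
    simp only [Finset.mem_sigma, mem_parts] at h ⊢
    obtain ⟨⟨h₁, h₂, h₃⟩, h₄, h₅, h₆⟩ := h
    have hd : Disjoint B A := Finset.disjoint_of_subset_left h₄ Finset.sdiff_disjoint
    refine ⟨⟨Finset.union_subset h₁ (h₄.trans Finset.sdiff_subset), ?_, ?_⟩,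
      Finset.subset_union_left, h₂, ?_⟩
    · intro h
      exact h₂ (Finset.union_eq_empty.1 h).1
    · intro h
      apply h₆
      rw [← h, Finset.union_sdiff_cancel_left hd.symm]
    · intro h
      apply h₅
      have h' : B ⊆ A := by
        rw [h]
        exact Finset.subset_union_right
      exact Finset.disjoint_self_iff_empty _ |>.1 (hd.mono_right h')
  · rintro ⟨A, B⟩ h
    simp only [Finset.mem_sigma, mem_parts] at h ⊢
    rw [Finset.union_sdiff_of_subset h.2.1]
  · rintro ⟨A, B⟩ h
    simp only [Finset.mem_sigma, mem_parts] at h ⊢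
    have hd : Disjoint B A := Finset.disjoint_of_subset_left h.2.1 Finset.sdiff_disjoint
    rw [Finset.union_sdiff_cancel_left hd.symm]
  · rintro ⟨A, B⟩ h
    simp only [Finset.mem_sigma, mem_parts] at h ⊢
    congr 1
    ext x
    simp only [Finset.mem_sdiff]
    have := @h.2.1 x
    tauto

/-- Multiplication by the even element `d x_S`, which is a cycle, commutes with `d`. -/
theorem d_dLetter (S : Finset X) (c : Chains X) : d (dLetter S c) = dLetter S (d c) := by
  have h₁ : ∀ A, d (cons A (cons (S \ A) c)) =
      (∑ B ∈ parts A, cons B (cons (A \ B) (cons (S \ A) c)) -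
        ∑ B ∈ parts (S \ A), cons A (cons B (cons ((S \ A) \ B) c))) +
      ((if A.card = 1 then cons (S \ A) c else 0) - (if (S \ A).card = 1 then cons A c else 0)) +
      cons A (cons (S \ A) (d c)) := by
    intro A
    simp only [d_cons, map_sub, dLetter_apply, map_add, map_sum]
    split_ifs <;> (try simp only [map_zero]) <;> abel
  have h₂ := sum_parts_assoc S (fun A B C => cons A (cons B (cons C c)))
  have h₃ := sum_parts_swap S (fun A B => if A.card = 1 then cons B c else 0)
  simp only [dLetter_apply, map_add, map_sum, h₁, Finset.sum_add_distrib, Finset.sum_sub_distrib]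
  rw [h₂, h₃]
  split_ifs <;> simp

theorem d_d (c : Chains X) : d (d c) = 0 := by
  suffices h : d ∘ₗ d = (0 : Chains X →ₗ[ℤ] Chains X) from congr($h c)
  refine chains_hom_ext fun w => ?_
  induction w with
  | nil => simp [d_single, dWord]
  | cons S w ih =>
    simp only [LinearMap.comp_apply, LinearMap.zero_apply] at ih ⊢
    rw [← cons_single, d_cons, map_sub, d_dLetter, d_cons, ih]
    simp

end Words

section Contraction
variable {X : Type*} [DecidableEq X] (a : X)

/-- The derivation that sends the letter `{a}` to `1` and the other letters to `0`, on words. -/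
def rWord : List (Finset X) → Chains X
  | [] => 0
  | S :: w => (if S = {a} then Finsupp.single w 1 else 0) - cons S (rWord w)

/-- The derivation that sends the letter `{a}` to `1` and the other letters to `0`. -/
def r : Chains X →ₗ[ℤ] Chains X := Finsupp.linearCombination ℤ (rWord a)

/-- The homotopy that moves the letter `{a}` to the front, on words. -/
def kWord : List (Finset X) → Chains X
  | [] => 0
  | S :: w => cons (insert a S) (rWord a w) - cons S (kWord w)

/-- The homotopy that moves the letter `{a}` to the front: it takes `u x_a v` to
`∑ ± u' x_{S ∪ a} u'' v`, the sum being over the decompositions `u = u' x_S u''`. -/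
def k : Chains X →ₗ[ℤ] Chains X := Finsupp.linearCombination ℤ (kWord a)

/-- The projection on the words without `a`, on words. -/
def pWord : List (Finset X) → Chains X
  | [] => Finsupp.single [] 1
  | S :: w => if a ∈ S then 0 else cons S (pWord w)

/-- The projection on the span of the words of which no letter contains `a`. -/
def p : Chains X →ₗ[ℤ] Chains X := Finsupp.linearCombination ℤ (pWord a)

/-- The contracting homotopy `c ↦ x_a p(c) + k(c)`, where `x_a` stands for the letter `{a}`. -/
def h : Chains X →ₗ[ℤ] Chains X := cons {a} ∘ₗ p a + k a

theorem r_single (w : List (Finset X)) : r a (Finsupp.single w 1) = rWord a w := by simp [r]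

theorem k_single (w : List (Finset X)) : k a (Finsupp.single w 1) = kWord a w := by simp [k]

theorem p_single (w : List (Finset X)) : p a (Finsupp.single w 1) = pWord a w := by simp [p]

theorem r_cons (S : Finset X) (c : Chains X) :
    r a (cons S c) = (if S = {a} then c else 0) - cons S (r a c) := by
  suffices h : r a ∘ₗ cons S = (if S = {a} then LinearMap.id else 0) - cons S ∘ₗ r a by
    have := congr($h c)
    split_ifs at this ⊢ <;> simpa using this
  refine chains_hom_ext fun w => ?_
  split_ifs <;> simp [cons_single, r_single, rWord, *]

theorem k_cons (S : Finset X) (c : Chains X) :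
    k a (cons S c) = cons (insert a S) (r a c) - cons S (k a c) := by
  suffices h : k a ∘ₗ cons S = cons (insert a S) ∘ₗ r a - cons S ∘ₗ k a from congr($h c)
  refine chains_hom_ext fun w => ?_
  simp [cons_single, r_single, k_single, kWord]

theorem p_cons (S : Finset X) (c : Chains X) :
    p a (cons S c) = if a ∈ S then 0 else cons S (p a c) := by
  suffices h : p a ∘ₗ cons S = if a ∈ S then 0 else cons S ∘ₗ p a by
    have := congr($h c)
    split_ifs at this ⊢ <;> simpa using this
  refine chains_hom_ext fun w => ?_
  split_ifs <;> simp [cons_single, p_single, pWord, *]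

theorem r_dLetter (S : Finset X) (c : Chains X) : r a (dLetter S c) = dLetter S (r a c) := by
  have h₁ : ∀ A, r a (cons A (cons (S \ A) c)) =
      ((if A = {a} then cons (S \ A) c else 0) - (if S \ A = {a} then cons A c else 0)) +
      cons A (cons (S \ A) (r a c)) := by
    intro A
    simp only [r_cons, map_sub]
    split_ifs <;> (try simp only [map_zero]) <;> abel
  have h₃ := sum_parts_swap S (fun A B => if A = {a} then cons B c else 0)
  simp only [dLetter_apply, map_add, map_sum, h₁, Finset.sum_add_distrib, Finset.sum_sub_distrib]
  rw [h₃]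
  split_ifs <;> simp

/-- The odd derivations `r a` and `d` anticommute, because `d x_S` is killed by `r a` for every letter
`S`. -/
theorem r_d_add_d_r (c : Chains X) : r a (d c) + d (r a c) = 0 := by
  suffices h : r a ∘ₗ d + d ∘ₗ r a = (0 : Chains X →ₗ[ℤ] Chains X) from congr($h c)
  refine chains_hom_ext fun w => ?_
  induction w with
  | nil => simp [d_single, r_single, dWord, rWord]
  | cons S w ih =>
    simp only [LinearMap.add_apply, LinearMap.comp_apply, LinearMap.zero_apply] at ih ⊢
    have ih' := congr(cons S $ih)
    rw [← cons_single, d_cons, map_sub, r_dLetter, r_cons, r_cons, map_sub, d_cons]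
    rw [map_add, map_zero] at ih'
    refine Eq.trans ?_ ih'
    split_ifs <;> (try simp only [map_zero]) <;> abel

end Contraction

section Degrees
variable {X : Type*} [DecidableEq X]

/-- `IsWord U n w`: the letters of `w` are pairwise disjoint nonempty subsets of `U`, and `w` has
degree `n`, where a letter `S` has degree `2 * #S - 1`. -/
def IsWord : Finset X → ℤ → List (Finset X) → Prop
  | _, n, [] => n = 0
  | U, n, S :: w => S.Nonempty ∧ S ⊆ U ∧ IsWord (U \ S) (n - (2 * S.card - 1)) w

/-- The span of the words of degree `n` in `U`. -/
def wordSpan (U : Finset X) (n : ℤ) : Submodule ℤ (Chains X) :=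
  Finsupp.supported ℤ ℤ {w | IsWord U n w}

theorem single_mem_wordSpan {U : Finset X} {n : ℤ} {w : List (Finset X)} (hw : IsWord U n w) :
    Finsupp.single w 1 ∈ wordSpan U n :=
  Finsupp.single_mem_supported _ _ hw

theorem wordSpan_induction {U : Finset X} {n : ℤ} {N : Submodule ℤ (Chains X)}
    (f : Chains X →ₗ[ℤ] Chains X) (hf : ∀ w, IsWord U n w → f (Finsupp.single w 1) ∈ N)
    {c : Chains X} (hc : c ∈ wordSpan U n) : f c ∈ N := by
  have : wordSpan U n ≤ N.comap f := by
    rw [wordSpan, Finsupp.supported_eq_span_single, Submodule.span_le]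
    rintro _ ⟨w, hw, rfl⟩
    exact hf w hw
  exact this hc

theorem cons_mem_wordSpan {U : Finset X} {n : ℤ} {S : Finset X} (hS : S.Nonempty) (hU : S ⊆ U)
    {c : Chains X} {V : Finset X} {m : ℤ} (hc : c ∈ wordSpan V m) (hV : V = U \ S)
    (hm : n = m + (2 * S.card - 1)) : cons S c ∈ wordSpan U n := by
  subst hV hm
  refine wordSpan_induction _ (fun w hw => ?_) hc
  rw [cons_single]
  exact single_mem_wordSpan ⟨hS, hU, by simpa using hw⟩

theorem IsWord.mono {U V : Finset X} (hUV : U ⊆ V) {n : ℤ} {w : List (Finset X)}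
    (hw : IsWord U n w) : IsWord V n w := by
  induction w generalizing U V n with
  | nil => exact hw
  | cons S w ih => exact ⟨hw.1, hw.2.1.trans hUV, ih (Finset.sdiff_subset_sdiff hUV subset_rfl) hw.2.2⟩

theorem wordSpan_mono {U V : Finset X} (hUV : U ⊆ V) (n : ℤ) : wordSpan U n ≤ wordSpan V n :=
  Finsupp.supported_mono fun _ hw => IsWord.mono hUV hw

theorem dLetter_mem_wordSpan {U S : Finset X} (hU : S ⊆ U) {c : Chains X} {m n : ℤ}
    (hc : c ∈ wordSpan (U \ S) m) (hn : n = m + (2 * S.card - 2)) : dLetter S c ∈ wordSpan U n := by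
  rw [dLetter_apply]
  refine Submodule.add_mem _ (Submodule.sum_mem _ fun A hA => ?_) ?_
  · obtain ⟨h₁, h₂, h₃⟩ := mem_parts.1 hA
    have h₄ := (mem_parts.1 (sdiff_mem_parts hA)).2.1
    have h₅ := Finset.card_sdiff_add_card_eq_card h₁
    refine cons_mem_wordSpan (Finset.nonempty_iff_ne_empty.2 h₂) (h₁.trans hU) (V := U \ A)
      (m := m + (2 * (S \ A).card - 1)) ?_ rfl ?_
    · refine cons_mem_wordSpan (Finset.nonempty_iff_ne_empty.2 h₄)
        (Finset.sdiff_subset_sdiff hU subset_rfl) hc ?_ rfl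
      ext x
      simp only [Finset.mem_sdiff]
      have := @h₁ x
      tauto
    · rw [hn, ← h₅]
      push_cast
      ring
  · split_ifs with h
    · rw [h] at hn
      obtain rfl : n = m := by simpa using hn
      exact wordSpan_mono Finset.sdiff_subset _ hc
    · exact Submodule.zero_mem _

theorem d_mem_wordSpan {U : Finset X} {n m : ℤ} (hm : m + 1 = n) {c : Chains X}
    (hc : c ∈ wordSpan U n) : d c ∈ wordSpan U m := by
  refine wordSpan_induction _ (fun w hw => ?_) hc
  clear hc c
  induction w generalizing U n m with
  | nil => simp [d_single, dWord]
  | cons S w ih =>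
    obtain ⟨h₁, h₂, h₃⟩ := hw
    rw [← cons_single, d_cons]
    refine Submodule.sub_mem _
      (dLetter_mem_wordSpan h₂ (single_mem_wordSpan h₃) (by lia))
      (cons_mem_wordSpan h₁ h₂ (ih (m := n - (2 * S.card - 1) - 1) (by lia) h₃) rfl (by lia))

section
variable {a : X}

theorem r_eq_zero {U : Finset X} {n : ℤ} {w : List (Finset X)} (hw : IsWord U n w) (ha : a ∉ U) :
    r a (Finsupp.single w 1) = 0 := by
  induction w generalizing U n with
  | nil => simp [r_single, rWord]
  | cons S w ih =>
    rw [← cons_single, r_cons, ih hw.2.2 (by simp [ha]), if_neg, map_zero, sub_zero]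
    rintro rfl
    exact ha (hw.2.1 (by simp))

theorem k_eq_zero {U : Finset X} {n : ℤ} {w : List (Finset X)} (hw : IsWord U n w) (ha : a ∉ U) :
    k a (Finsupp.single w 1) = 0 := by
  induction w generalizing U n with
  | nil => simp [k_single, kWord]
  | cons S w ih =>
    rw [← cons_single, k_cons, ih hw.2.2 (by simp [ha]), r_eq_zero hw.2.2 (by simp [ha])]
    simp

theorem p_eq_self {U : Finset X} {n : ℤ} {w : List (Finset X)} (hw : IsWord U n w) (ha : a ∉ U) :
    p a (Finsupp.single w 1) = Finsupp.single w 1 := by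
  induction w generalizing U n with
  | nil => simp [p_single, pWord]
  | cons S w ih =>
    rw [← cons_single, p_cons, ih hw.2.2 (by simp [ha]), if_neg]
    exact fun h => ha (hw.2.1 h)

theorem r_eq_zero_of_mem {U : Finset X} {n : ℤ} {c : Chains X} (hc : c ∈ wordSpan U n)
    (ha : a ∉ U) : r a c = 0 :=
  (Submodule.mem_bot ℤ).1 (wordSpan_induction _
    (fun _ hw => (Submodule.mem_bot ℤ).2 (r_eq_zero hw ha)) hc)

theorem k_eq_zero_of_mem {U : Finset X} {n : ℤ} {c : Chains X} (hc : c ∈ wordSpan U n)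
    (ha : a ∉ U) : k a c = 0 :=
  (Submodule.mem_bot ℤ).1 (wordSpan_induction _
    (fun _ hw => (Submodule.mem_bot ℤ).2 (k_eq_zero hw ha)) hc)

theorem p_eq_self_of_mem {U : Finset X} {n : ℤ} {c : Chains X} (hc : c ∈ wordSpan U n)
    (ha : a ∉ U) : p a c = c := by
  have := (Submodule.mem_bot ℤ).1 (wordSpan_induction (p a - LinearMap.id)
    (fun w hw => (Submodule.mem_bot ℤ).2 (by simp [p_eq_self hw ha])) hc)
  simpa [sub_eq_zero] using this

theorem p_mem_wordSpan {U : Finset X} {n : ℤ} {c : Chains X} (hc : c ∈ wordSpan U n) :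
    p a c ∈ wordSpan (U \ {a}) n := by
  refine wordSpan_induction _ (fun w hw => ?_) hc
  clear hc c
  induction w generalizing U n with
  | nil =>
    rw [p_single]
    exact single_mem_wordSpan hw
  | cons S w ih =>
    rw [← cons_single, p_cons]
    split_ifs with h
    · exact Submodule.zero_mem _
    · exact cons_mem_wordSpan hw.1 (fun x hx => by
        simp only [Finset.mem_sdiff, Finset.mem_singleton]
        exact ⟨hw.2.1 hx, fun h' => h (h' ▸ hx)⟩) (ih hw.2.2) sdiff_sdiff_comm (by lia)

theorem r_mem_wordSpan {U : Finset X} {n m : ℤ} (hm : m + 1 = n) {c : Chains X}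
    (hc : c ∈ wordSpan U n) : r a c ∈ wordSpan (U \ {a}) m := by
  refine wordSpan_induction _ (fun w hw => ?_) hc
  clear hc c
  induction w generalizing U n m with
  | nil => simp [r_single, rWord]
  | cons S w ih =>
    rw [← cons_single, r_cons]
    refine Submodule.sub_mem _ ?_ ?_
    · split_ifs with h
      · subst h
        convert single_mem_wordSpan hw.2.2 using 2
        simp
        lia
      · exact Submodule.zero_mem _
    · by_cases h : a ∈ S
      · rw [r_eq_zero hw.2.2 (by simp [h])]
        simp
      · exact cons_mem_wordSpan hw.1 (fun x hx => by
          simp only [Finset.mem_sdiff, Finset.mem_singleton]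
          exact ⟨hw.2.1 hx, fun h' => h (h' ▸ hx)⟩)
          (ih (m := n - (2 * S.card - 1) - 1) (by lia) hw.2.2) sdiff_sdiff_comm (by lia)

theorem k_mem_wordSpan {U : Finset X} (ha : a ∈ U) {n m : ℤ} (hm : n + 1 = m) {c : Chains X}
    (hc : c ∈ wordSpan U n) : k a c ∈ wordSpan U m := by
  refine wordSpan_induction _ (fun w hw => ?_) hc
  clear hc c
  induction w generalizing U n m with
  | nil => simp [k_single, kWord]
  | cons S w ih =>
    rw [← cons_single, k_cons]
    by_cases h : a ∈ S
    · rw [r_eq_zero hw.2.2 (by simp [h]), k_eq_zero hw.2.2 (by simp [h])]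
      simp
    · refine Submodule.sub_mem _ ?_ ?_
      · refine cons_mem_wordSpan (by simp) ?_
          (r_mem_wordSpan (m := n - (2 * S.card - 1) - 1) (by lia) (single_mem_wordSpan hw.2.2))
          ?_ ?_
        · exact Finset.insert_subset ha hw.2.1
        · rw [sdiff_sdiff_left, Finset.insert_eq, Finset.union_comm]; rfl
        · rw [Finset.card_insert_of_notMem h]
          push_cast
          lia
      · exact cons_mem_wordSpan hw.1 hw.2.1 (ih (by simp [ha, h]) rfl hw.2.2) rfl (by lia)

theorem h_mem_wordSpan {U : Finset X} (ha : a ∈ U) {n m : ℤ} (hm : n + 1 = m) {c : Chains X}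
    (hc : c ∈ wordSpan U n) : h a c ∈ wordSpan U m :=
  Submodule.add_mem _
    (cons_mem_wordSpan (by simp) (by simpa using ha) (p_mem_wordSpan hc) rfl (by simpa using hm.symm))
    (k_mem_wordSpan ha hm hc)

/-- `p` fails to commute with the differential by the terms in which the letter `{a}` is removed.
This and the following identities hold on words with disjoint letters only. -/
theorem p_d {U : Finset X} {n : ℤ} {w : List (Finset X)} (hw : IsWord U n w) :
    p a (d (Finsupp.single w 1)) = d (p a (Finsupp.single w 1)) + r a (Finsupp.single w 1) := by
  by_cases ha : a ∈ U
  swap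
  · rw [p_eq_self hw ha, r_eq_zero hw ha, add_zero,
      p_eq_self_of_mem (d_mem_wordSpan (sub_add_cancel n 1) (single_mem_wordSpan hw)) ha]
  induction w generalizing U n with
  | nil => simp [d_single, p_single, pWord, r_single, rWord, dWord]
  | cons S w ih =>
    obtain ⟨h₁, h₂, h₃⟩ := hw
    rw [← cons_single, d_cons, map_sub, p_cons, p_cons, r_cons]
    by_cases hS : a ∈ S
    · have haU : a ∉ U \ S := by simp [hS]
      rw [if_pos hS, if_pos hS, r_eq_zero h₃ haU, dLetter_apply, map_add, map_sum]
      have h₄ : ∀ A ∈ parts S, p a (cons A (cons (S \ A) (Finsupp.single w 1))) = 0 := by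
        intro A hA
        rw [p_cons, p_cons]
        by_cases h : a ∈ A <;> simp [h, hS]
      rw [Finset.sum_eq_zero h₄]
      have h₅ : S.card = 1 ↔ S = {a} := by
        rw [Finset.card_eq_one]
        constructor
        · rintro ⟨b, rfl⟩
          rw [Finset.mem_singleton.1 hS]
        · rintro rfl
          exact ⟨a, rfl⟩
      simp only [h₅]
      split_ifs <;> simp [p_eq_self h₃ haU]
    · have hSa : S ≠ {a} := by
        rintro rfl
        simp at hS
      have h₄ : p a (dLetter S (Finsupp.single w 1)) = dLetter S (p a (Finsupp.single w 1)) := by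
        simp only [dLetter_apply, map_add, map_sum]
        congr 1
        · refine Finset.sum_congr rfl fun A hA => ?_
          rw [p_cons, p_cons, if_neg, if_neg]
          · simp [hS]
          · exact fun h => hS ((mem_parts.1 hA).1 h)
        · split_ifs <;> simp
      rw [if_neg hS, if_neg hS, if_neg hSa, h₄, d_cons, ih h₃ (by simp [ha, hS])]
      simp only [map_add]
      abel

/-- `k a` is a homotopy between the identity and `c ↦ p(c) + x_a r(c)`. -/
theorem d_k_add_k_d {U : Finset X} {n : ℤ} {w : List (Finset X)} (hw : IsWord U n w) :
    d (k a (Finsupp.single w 1)) + k a (d (Finsupp.single w 1)) =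
      Finsupp.single w 1 - p a (Finsupp.single w 1) - cons {a} (r a (Finsupp.single w 1)) := by
  by_cases ha : a ∈ U
  swap
  · rw [p_eq_self hw ha, r_eq_zero hw ha, k_eq_zero hw ha,
      k_eq_zero_of_mem (d_mem_wordSpan (sub_add_cancel n 1) (single_mem_wordSpan hw)) ha]
    simp
  induction w generalizing U n with
  | nil => simp [d_single, p_single, pWord, r_single, rWord, dWord, k_single, kWord]
  | cons S w ih =>
    obtain ⟨h₁, h₂, h₃⟩ := hw
    by_cases hS : a ∈ S
    · -- The letter `a` occurs in `S` only, so that `r a`, `k a` and `p a` are trivial on the rest.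
      have haU : a ∉ U \ S := by simp [hS]
      have hd := d_mem_wordSpan (sub_add_cancel _ 1) (single_mem_wordSpan h₃)
      have hr := r_eq_zero h₃ haU
      have hk := k_eq_zero h₃ haU
      rw [← cons_single, d_cons, map_sub, k_cons, k_cons, p_cons, r_cons, if_pos hS,
        r_eq_zero_of_mem hd haU, k_eq_zero_of_mem hd haU, hr, hk]
      simp only [map_zero, sub_zero, zero_add]
      set c : Chains X := Finsupp.single w 1 with hc
      obtain ⟨B, haB, rfl⟩ : ∃ B, a ∉ B ∧ S = insert a B :=
        ⟨S.erase a, by simp, (Finset.insert_erase hS).symm⟩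
      obtain rfl | hB := B.eq_empty_or_nonempty
      · simp [dLetter_apply, hk]
      · have h₄ : insert a B ≠ {a} := by
          obtain ⟨b, hb⟩ := hB
          intro h
          have h' : b ∈ insert a B := by simp [hb]
          rw [h, Finset.mem_singleton] at h'
          exact haB (h' ▸ hb)
        have h₅ : (insert a B).card ≠ 1 := by
          rw [Finset.card_insert_of_notMem haB]
          have := hB.card_pos
          lia
        have h₆ : ∀ C ∈ parts B, C ≠ {a} ∧ insert a C ≠ {a} := by
          intro C hC
          obtain ⟨h₁, h₂, -⟩ := mem_parts.1 hC
          obtain ⟨b, hb⟩ := Finset.nonempty_iff_ne_empty.2 h₂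
          refine ⟨?_, ?_⟩
          · rintro rfl
            exact haB (h₁ (by simp))
          · intro h
            have h' : b ∈ insert a C := by simp [hb]
            rw [h, Finset.mem_singleton] at h'
            exact haB (h₁ (h' ▸ hb))
        have hBa : B ≠ {a} := by
          rintro rfl
          simp at haB
        rw [dLetter_apply, if_neg h₄, if_neg h₅, add_zero, map_sum,
          sum_parts_insert hB haB (fun A C => k a (cons A (cons C c))), Finset.sum_eq_zero]
        · simp [k_cons, r_cons, hr, hk, hBa]
        · intro A hA
          have h₇ := h₆ _ (sdiff_mem_parts hA)
          simp [k_cons, r_cons, hr, hk, h₇.1, h₇.2]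
    · have hSa : S ≠ {a} := by
        rintro rfl
        simp at hS
      have haU : a ∈ U \ S := by simp [ha, hS]
      have ih' := congr(cons S $(ih h₃ haU))
      have hrd := congr(cons (insert a S) $(r_d_add_d_r a (Finsupp.single w 1)))
      have h₅ : (insert a S).card ≠ 1 := by
        rw [Finset.card_insert_of_notMem hS]
        have := h₁.card_pos
        lia
      rw [← cons_single, d_cons, map_sub, k_cons, k_cons, p_cons, r_cons, if_neg hS, if_neg hSa,
        map_sub, d_cons, d_cons]
      set c : Chains X := Finsupp.single w 1 with hc
      have h₆ : k a (dLetter S c) = dLetter S (k a c) -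
          ∑ A ∈ parts S, (cons (insert a A) (cons (S \ A) (r a c)) +
            cons A (cons (insert a (S \ A)) (r a c))) := by
        rw [dLetter_apply, dLetter_apply, map_add, map_sum]
        have : ∀ A ∈ parts S, k a (cons A (cons (S \ A) c)) = cons A (cons (S \ A) (k a c)) -
            (cons (insert a A) (cons (S \ A) (r a c)) +
            cons A (cons (insert a (S \ A)) (r a c))) := by
          intro A hA
          have h' : S \ A ≠ {a} := by
            intro h
            exact hS ((mem_parts.1 (sdiff_mem_parts hA)).1 (by simp [h]))
          simp only [k_cons, r_cons, if_neg h', map_sub, map_zero]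
          abel
        rw [Finset.sum_congr rfl this, Finset.sum_sub_distrib]
        split_ifs
        · abel
        · simp
      have h₇ : dLetter (insert a S) (r a c) = cons {a} (cons S (r a c)) +
          cons S (cons {a} (r a c)) + ∑ A ∈ parts S, (cons (insert a A) (cons (S \ A) (r a c)) +
            cons A (cons (insert a (S \ A)) (r a c))) := by
        rw [dLetter_apply, if_neg h₅, add_zero,
          sum_parts_insert h₁ hS (fun A C => cons A (cons C (r a c)))]
      rw [h₆, h₇]
      simp only [map_sub, map_add, map_zero, zero_sub, map_neg] at ih' hrd ⊢
      rw [← sub_eq_zero] at ih' ⊢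
      rw [← ih', ← sub_eq_zero, ← neg_eq_zero, ← hrd]
      abel

/-- `h a` is a contracting homotopy. -/
theorem d_h_add_h_d {U : Finset X} {n : ℤ} {c : Chains X} (hc : c ∈ wordSpan U n) :
    d (h a c) + h a (d c) = c := by
  suffices H : ∀ w, IsWord U n w →
      (d ∘ₗ h a + h a ∘ₗ d - LinearMap.id : Chains X →ₗ[ℤ] Chains X) (Finsupp.single w 1) ∈
        (⊥ : Submodule ℤ (Chains X)) by
    have := (Submodule.mem_bot ℤ).1 (wordSpan_induction _ H hc)
    simpa [sub_eq_zero] using this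
  intro w hw
  rw [Submodule.mem_bot]
  have h₁ := p_d (a := a) hw
  have h₂ := d_k_add_k_d (a := a) hw
  have h₃ : ∀ c, dLetter {a} c = c := fun c => by
    simp [dLetter_apply]
  simp only [h, LinearMap.sub_apply, LinearMap.add_apply, LinearMap.comp_apply,
    LinearMap.id_apply, map_add, d_cons, h₁, h₃]
  rw [sub_sub, eq_sub_iff_add_eq] at h₂
  rw [sub_eq_zero]
  refine Eq.trans ?_ h₂
  abel

end

end Degrees

end WordComplex

/-! ### Diagonal actions on modules of functions -/

section Diag
variable {R : Type u} [CommRing R] {G : Type v} [Group G]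

/-- Additive maps that commute with the action of the elements `c g` are `RG`-linear. -/
def linearMapOfSingle {M N : Type*} [AddCommGroup M] [AddCommGroup N]
    [Module (MonoidAlgebra R G) M] [Module (MonoidAlgebra R G) N] (f : M →+ N)
    (hf : ∀ (g : G) (c : R) (x : M),
      f (MonoidAlgebra.single g c • x) = MonoidAlgebra.single g c • f x) :
    M →ₗ[MonoidAlgebra R G] N where
  toFun := f
  map_add' := f.map_add
  map_smul' r x := by
    induction r using MonoidAlgebra.induction_linear with
    | zero => simp
    | add a b ha hb => simp only [add_smul, map_add, ha, hb, RingHom.id_apply]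
    | single g c => exact hf g c x

/-- Additive equivalences that commute with the action of the elements `c g` are `RG`-linear. -/
def linearEquivOfSingle {M N : Type*} [AddCommGroup M] [AddCommGroup N]
    [Module (MonoidAlgebra R G) M] [Module (MonoidAlgebra R G) N] (f : M ≃+ N)
    (hf : ∀ (g : G) (c : R) (x : M),
      f (MonoidAlgebra.single g c • x) = MonoidAlgebra.single g c • f x) :
    M ≃ₗ[MonoidAlgebra R G] N :=
  { f with map_smul' := (linearMapOfSingle f.toAddMonoidHom hf).map_smul' }

variable (R G) (X : Type v) [MulAction G X] (M : Type (max u v)) [AddCommGroup M]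
  [Module (MonoidAlgebra R G) M]

/-- The diagonal action of `G` on the functions `X → M`. -/
def diagRep : Representation R G (X → RestrictScalars R (MonoidAlgebra R G) M) where
  toFun g :=
    { toFun f x := Representation.ofModule M g (f (g⁻¹ • x))
      map_add' _ _ := by ext; simp
      map_smul' _ _ := by ext; simp }
  map_one' := by ext; simp
  map_mul' _ _ := by ext; simp [mul_smul]

/-- The `RG`-module of functions `X → M` with the diagonal action; for `X` finite, it is the tensor
product over `R` of `M` with the permutation module `R(X)`. -/
def Diag : Type (max u v) := (diagRep R G X M).asModule

instance : AddCommGroup (Diag R G X M) := inferInstanceAs (AddCommGroup (diagRep R G X M).asModule)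
instance : Module (MonoidAlgebra R G) (Diag R G X M) :=
  inferInstanceAs (Module (MonoidAlgebra R G) (diagRep R G X M).asModule)

instance [Finite G] [Finite X] [Module.Finite (MonoidAlgebra R G) M] :
    Module.Finite (MonoidAlgebra R G) (Diag R G X M) := by
  have h₁ : Module.Finite R (MonoidAlgebra R G) :=
    Module.Finite.equiv (MonoidAlgebra.coeffLinearEquiv R).symm
  let _ : Module (MonoidAlgebra R G) (RestrictScalars R (MonoidAlgebra R G) M) :=
    RestrictScalars.moduleOrig R _ M
  have : Module.Finite (MonoidAlgebra R G) (RestrictScalars R (MonoidAlgebra R G) M) :=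
    inferInstanceAs (Module.Finite (MonoidAlgebra R G) M)
  have h₂ : Module.Finite R (RestrictScalars R (MonoidAlgebra R G) M) :=
    Module.Finite.trans (MonoidAlgebra R G) _
  exact Module.Finite.of_restrictScalars_finite R (MonoidAlgebra R G) (diagRep R G X M).asModule

variable {R G X M}

/-- An element of `Diag R G X M`, as a function. -/
def Diag.toFun : Diag R G X M ≃+ (X → M) := AddEquiv.refl (X → M)

theorem Diag.single_smul (g : G) (c : R) (f : Diag R G X M) (x : X) :
    Diag.toFun (MonoidAlgebra.single g c • f) x =
      MonoidAlgebra.single g c • Diag.toFun f (g⁻¹ • x) := by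
  have h := congr_fun (Representation.single_smul (diagRep R G X M) c g f) x
  refine h.trans ?_
  change MonoidAlgebra.single (1 : G) c • (MonoidAlgebra.single g (1 : R) • (Diag.toFun f (g⁻¹ • x))) = _
  rw [smul_smul, MonoidAlgebra.single_mul_single, one_mul, mul_one]

theorem Diag.ext {f f' : Diag R G X M} (h : ∀ x, f.toFun x = f'.toFun x) : f = f' :=
  funext h

section
variable {N : Type (max u v)} [AddCommGroup N] [Module (MonoidAlgebra R G) N]

/-- Postcomposition with a linear map. -/
def Diag.map (φ : M →ₗ[MonoidAlgebra R G] N) :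
    Diag R G X M →ₗ[MonoidAlgebra R G] Diag R G X N :=
  linearMapOfSingle (Diag.toFun.symm.toAddMonoidHom.comp
      ((AddMonoidHom.compLeft φ.toAddMonoidHom X).comp Diag.toFun.toAddMonoidHom)) (by
    intro g c f
    refine Diag.ext fun x => ?_
    rw [Diag.single_smul]
    change φ (Diag.toFun (MonoidAlgebra.single g c • f) x) = _ • φ _
    rw [Diag.single_smul, map_smul]
    rfl)

variable {Y : Type v} [MulAction G Y]

/-- The linear map given by an integral matrix that is invariant under `G`. -/
def Diag.matrix [Fintype X] (c : X → Y → ℤ) (hc : ∀ (g : G) x y, c (g • x) (g • y) = c x y) :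
    Diag R G X M →ₗ[MonoidAlgebra R G] Diag R G Y M :=
  linearMapOfSingle
    { toFun f := Diag.toFun.symm fun y => ∑ x, c x y • f.toFun x
      map_zero' := by
        refine Diag.ext fun y => ?_
        simp
      map_add' f f' := by
        refine Diag.ext fun y => ?_
        simp [Finset.sum_add_distrib] } (by
    intro g r f
    refine Diag.ext fun y => ?_
    rw [Diag.single_smul]
    simp only [AddMonoidHom.coe_mk, ZeroHom.coe_mk, AddEquiv.apply_symm_apply, Finset.smul_sum]
    refine Fintype.sum_equiv (MulAction.toPerm g⁻¹) _ _ fun x => ?_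
    rw [Diag.single_smul, MulAction.toPerm_apply, hc, smul_comm])

/-- `R(A)`, as a module of functions. -/
def ofMulActionToFun (A : Type v) [MulAction G A] [Finite A] :
    (Representation.ofMulAction R G A).asModule ≃+ (A → R) :=
  ((MonoidAlgebra.coeffLinearEquiv (S := R) (M := A) R).trans
    (Finsupp.linearEquivFunOnFinite R R A)).toAddEquiv

theorem ofMulActionToFun_single_smul (A : Type v) [MulAction G A] [Finite A] (g : G) (c : R)
    (f : (Representation.ofMulAction R G A).asModule) (a : A) :
    ofMulActionToFun A (MonoidAlgebra.single g c • f) a = c * ofMulActionToFun A f (g⁻¹ • a) := by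
  rw [Representation.single_smul]
  change MonoidAlgebra.coeff (c • Representation.ofMulAction R G A g f) a = _
  rw [MonoidAlgebra.coeff_smul, Finsupp.smul_apply]
  exact congrArg (c * ·) (Representation.coeff_ofMulAction (k := R) g
    (show MonoidAlgebra R A from f) a)

/-- Tensoring `R(A)` with `R(X)` gives `R(X × A)`. -/
def diagEquivOfMulAction [Finite X] (A : Type v) [MulAction G A] [Finite A]
    (e : M ≃ₗ[MonoidAlgebra R G] (Representation.ofMulAction R G A).asModule) :
    Diag R G X M ≃ₗ[MonoidAlgebra R G] (Representation.ofMulAction R G (X × A)).asModule :=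
  linearEquivOfSingle
    ((Diag.toFun.trans (AddEquiv.arrowCongr (Equiv.refl X)
      (e.toAddEquiv.trans (ofMulActionToFun A)))).trans
        ({ Equiv.curry X A R with map_add' _ _ := rfl } : (X × A → R) ≃+ (X → A → R)).symm |>.trans
      (ofMulActionToFun (X × A)).symm) (by
    intro g c f
    apply (ofMulActionToFun (X × A)).injective
    ext ⟨x, a⟩
    rw [ofMulActionToFun_single_smul]
    simp only [AddEquiv.trans_apply, AddEquiv.apply_symm_apply]
    change ofMulActionToFun A (e (Diag.toFun (MonoidAlgebra.single g c • f) x)) a =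
      c * ofMulActionToFun A (e (Diag.toFun f (g⁻¹ • x))) (g⁻¹ • a)
    rw [Diag.single_smul, map_smul, ofMulActionToFun_single_smul])

end

variable (R G) in
/-- The modules isomorphic to `R(A)` for some finite free `G`-set `A`. -/
def IsFreePermutationModule (M : Type (max u v)) [AddCommGroup M] [Module (MonoidAlgebra R G) M] :
    Prop :=
  ∃ (A : Type v) (_ : Finite A) (_ : MulAction G A),
    (∀ (g : G) (a : A), g • a = a → g = 1) ∧
    Nonempty (M ≃ₗ[MonoidAlgebra R G] (Representation.ofMulAction R G A).asModule)

theorem IsFreePermutationModule.isPermutationModule (h : IsFreePermutationModule R G M) :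
    IsPermutationModule R G M := by
  obtain ⟨A, _, _, -, h⟩ := h
  exact ⟨A, inferInstance, inferInstance, h⟩

theorem IsPermutationModule.diag [Finite X] (h : IsPermutationModule R G M) :
    IsPermutationModule R G (Diag R G X M) := by
  obtain ⟨A, _, _, ⟨e⟩⟩ := h
  exact ⟨X × A, inferInstance, inferInstance, ⟨diagEquivOfMulAction A e⟩⟩

theorem IsFreePermutationModule.diag [Finite X] (h : IsFreePermutationModule R G M) :
    IsFreePermutationModule R G (Diag R G X M) := by
  obtain ⟨A, _, _, hA, ⟨e⟩⟩ := h
  exact ⟨X × A, inferInstance, inferInstance, fun g x hx => hA g x.2 (congr_arg Prod.snd hx),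
    ⟨diagEquivOfMulAction A e⟩⟩

theorem IsPermutationModule.diag_of_free [Finite X] (hX : ∀ (g : G) (x : X), g • x = x → g = 1)
    (h : IsPermutationModule R G M) : IsFreePermutationModule R G (Diag R G X M) := by
  obtain ⟨A, _, _, ⟨e⟩⟩ := h
  exact ⟨X × A, inferInstance, inferInstance, fun g x hx => hX g x.1 (congr_arg Prod.fst hx),
    ⟨diagEquivOfMulAction A e⟩⟩

theorem IsFreePermutationModule.prod {N : Type (max u v)} [AddCommGroup N]
    [Module (MonoidAlgebra R G) N]
    (hM : IsFreePermutationModule R G M) (hN : IsFreePermutationModule R G N) :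
    IsFreePermutationModule R G (M × N) := by
  obtain ⟨A, _, _, hA, ⟨e⟩⟩ := hM
  obtain ⟨B, _, _, hB, ⟨f⟩⟩ := hN
  refine ⟨A ⊕ B, inferInstance, inferInstance, ?_, ⟨(e.prodCongr f).trans (sumEquiv A B)⟩⟩
  rintro g (a | b) h
  · exact hA g a (Sum.inl_injective h)
  · exact hB g b (Sum.inr_injective h)

theorem isFreePermutationModule_of_subsingleton [Subsingleton M] : IsFreePermutationModule R G M := by
  let _ : MulAction G PEmpty.{v + 1} :=
    { smul := fun _ x => x, one_smul := fun x => x.elim, mul_smul := fun _ _ x => x.elim }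
  have : Subsingleton (Representation.ofMulAction R G PEmpty.{v + 1}).asModule :=
    (MonoidAlgebra.coeffLinearEquiv (S := R) (M := PEmpty.{v + 1}) R).toEquiv.subsingleton
  exact ⟨PEmpty, inferInstance, inferInstance, fun g x => x.elim, ⟨LinearEquiv.ofSubsingleton _ _⟩⟩

theorem IsPermutationModule.of_equiv {N : Type (max u v)} [AddCommGroup N]
    [Module (MonoidAlgebra R G) N] (e : M ≃ₗ[MonoidAlgebra R G] N) (hN : IsPermutationModule R G N) :
    IsPermutationModule R G M := by
  obtain ⟨A, _, _, ⟨f⟩⟩ := hN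
  exact ⟨A, inferInstance, inferInstance, ⟨e.trans f⟩⟩

theorem IsFreePermutationModule.of_equiv {N : Type (max u v)} [AddCommGroup N]
    [Module (MonoidAlgebra R G) N] (e : M ≃ₗ[MonoidAlgebra R G] N)
    (hN : IsFreePermutationModule R G N) : IsFreePermutationModule R G M := by
  obtain ⟨A, _, _, hA, ⟨f⟩⟩ := hN
  exact ⟨A, inferInstance, inferInstance, hA, ⟨e.trans f⟩⟩

/-- If `G` acts freely on `A`, then choosing representatives of the orbits identifies `R(A)` with
the module of functions from the set of orbits to `RG`. -/
theorem IsFreePermutationModule.free [Finite G] (h : IsFreePermutationModule R G M) :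
    Module.Free (MonoidAlgebra R G) M := by
  obtain ⟨A, _, _, hA, ⟨e⟩⟩ := h
  let O := MulAction.orbitRel.Quotient G A
  have : Finite O := inferInstanceAs (Finite (Quotient _))
  let φ : G × O → A := fun x => x.1 • x.2.out
  have hφ : Function.Bijective φ := by
    constructor
    · rintro ⟨g, o⟩ ⟨g', o'⟩ h
      have h' : g • o.out = g' • o'.out := h
      have ho : o = o' := by
        refine (Quotient.out_equiv_out (s := MulAction.orbitRel G A)).1 ⟨g⁻¹ * g', ?_⟩
        change (g⁻¹ * g') • o'.out = o.out
        rw [mul_smul, ← h', inv_smul_smul]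
      subst ho
      have : g'⁻¹ * g = 1 := hA _ o.out (by rw [mul_smul, h', inv_smul_smul])
      rw [inv_mul_eq_one] at this
      rw [this]
    · intro a
      obtain ⟨g, hg⟩ : a ∈ MulAction.orbit G (Quotient.mk (MulAction.orbitRel G A) a).out :=
        (MulAction.orbitRel G A).symm' (Quotient.mk_out (s := MulAction.orbitRel G A) a)
      exact ⟨⟨g, _⟩, hg⟩
  let φ' := Equiv.ofBijective φ hφ
  let ψ : (O → MonoidAlgebra R G) ≃+ (Representation.ofMulAction R G A).asModule :=
    ((AddEquiv.arrowCongr (Equiv.refl O) ((MonoidAlgebra.coeffLinearEquiv (S := R) (M := G) R).trans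
      (Finsupp.linearEquivFunOnFinite R R G)).toAddEquiv).trans
      ({ toFun f a := f (φ'.symm a).2 (φ'.symm a).1
         invFun f o g := f (φ' (g, o))
         left_inv f := by ext; simp
         right_inv f := by ext; simp
         map_add' _ _ := rfl } : (O → G → R) ≃+ (A → R))).trans (ofMulActionToFun A).symm
  have hψ : ∀ (g : G) (c : R) (f : O → MonoidAlgebra R G),
      ψ (MonoidAlgebra.single g c • f) = MonoidAlgebra.single g c • ψ f := by
    intro g c f
    apply (ofMulActionToFun A).injective
    ext a
    rw [ofMulActionToFun_single_smul]
    simp only [ψ, AddEquiv.trans_apply, AddEquiv.apply_symm_apply]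
    obtain ⟨⟨h, o⟩, rfl⟩ := φ'.surjective a
    have h₁ : g⁻¹ • φ' (h, o) = φ' (g⁻¹ * h, o) := (mul_smul g⁻¹ h o.out).symm
    change (MonoidAlgebra.single g c * f (φ'.symm (φ' (h, o))).2).coeff (φ'.symm (φ' (h, o))).1 =
      c * (f (φ'.symm (g⁻¹ • φ' (h, o))).2).coeff (φ'.symm (g⁻¹ • φ' (h, o))).1
    rw [h₁, Equiv.symm_apply_apply, Equiv.symm_apply_apply]
    exact MonoidAlgebra.coeff_single_mul_apply _ _ _ _
  exact Module.Free.of_equiv ((linearEquivOfSingle ψ hψ).trans e.symm)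

end Diag

/-! ### Iterated mapping cones -/

section IteratedCone
variable {C : Type u} [Category.{v} C] [Abelian C]

open CochainComplex

attribute [local instance] HasDerivedCategory.standard in
theorem quasiIso_mappingCone_map {K₁ L₁ K₂ L₂ : CochainComplex C ℤ} (φ₁ : K₁ ⟶ L₁) (φ₂ : K₂ ⟶ L₂)
    (a : K₁ ⟶ K₂) (b : L₁ ⟶ L₂) (comm : φ₁ ≫ b = a ≫ φ₂) [QuasiIso a] [QuasiIso b] :
    QuasiIso (mappingCone.map φ₁ φ₂ a b comm) := by
  rw [← DerivedCategory.isIso_Q_map_iff_quasiIso]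
  have h := isIso₃_of_isIso₁₂ (DerivedCategory.Q.mapTriangle.map
    (mappingCone.triangleMap φ₁ φ₂ a b comm))
    (DerivedCategory.mappingCone_triangle_distinguished φ₁)
    (DerivedCategory.mappingCone_triangle_distinguished φ₂)
    (inferInstanceAs (IsIso (DerivedCategory.Q.map a)))
    (inferInstanceAs (IsIso (DerivedCategory.Q.map b)))
  exact h

/-- A bounded exact sequence of complexes `⋯ ⟶ K 1 ⟶ K 0 ⟶ Z ⟶ 0` gives a quasi-isomorphism from an
iterated mapping cone to `Z`. Its term in degree `n` is built from the `(K e).X (n + e)` by biproducts,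
which is expressed through the properties `q` that are inherited by it. -/
theorem exists_quasiIso_of_resolution (l : ℕ) (K : ℕ → CochainComplex C ℤ)
    (δ : ∀ e, K (e + 1) ⟶ K e) (Z : CochainComplex C ℤ) (π : K 0 ⟶ Z) [Epi π]
    (hπ : δ 0 ≫ π = 0) (hδ : ∀ e, δ (e + 1) ≫ δ e = 0)
    (exπ : (ShortComplex.mk _ _ hπ).Exact) (exδ : ∀ e, (ShortComplex.mk _ _ (hδ e)).Exact)
    (hK : ∀ e, l ≤ e → IsZero (K e)) :
    ∃ (L : CochainComplex C ℤ) (ψ : L ⟶ Z), QuasiIso ψ ∧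
      ∀ (q : ObjectProperty C) [q.IsClosedUnderIsomorphisms], (∀ X, IsZero X → q X) →
        (∀ X Y, q X → q Y → q (X ⊞ Y)) → ∀ n : ℤ, (∀ e : ℕ, q ((K e).X (n + e))) → q (L.X n) := by
  induction l generalizing K Z with
  | zero =>
    have hZ : IsZero Z := by
      rw [IsZero.iff_id_eq_zero, ← cancel_epi π]
      exact (hK 0 le_rfl).eq_of_src _ _
    exact ⟨Z, 𝟙 Z, inferInstance, fun q _ h₀ _ n _ =>
      h₀ _ (Functor.map_isZero (HomologicalComplex.eval C (.up ℤ) n) hZ)⟩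
  | succ l ih =>
    -- Resolve `kernel π` by the truncated sequence, and replace `Z` by the cone of `kernel π ⟶ K 0`.
    let δ' : K 1 ⟶ kernel π := kernel.lift π (δ 0) hπ
    have hδ' : δ' ≫ kernel.ι π = δ 0 := kernel.lift_ι _ _ _
    have : Epi δ' := (ShortComplex.exact_iff_epi_kernel_lift _).1 exπ
    have hδ'' : δ 1 ≫ δ' = 0 := by
      rw [← cancel_mono (kernel.ι π), assoc, hδ', hδ, zero_comp]
    have exδ' : (ShortComplex.mk (δ 1) δ' hδ'').Exact := by
      have h := exδ 0
      let f : ShortComplex.mk (δ 1) δ' hδ'' ⟶ ShortComplex.mk (δ 1) (δ 0) (hδ 0) :=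
        { τ₁ := 𝟙 _, τ₂ := 𝟙 _, τ₃ := kernel.ι π
          comm₁₂ := by simp, comm₂₃ := by simp [hδ'] }
      have : Epi f.τ₁ := inferInstanceAs (Epi (𝟙 _))
      have : IsIso f.τ₂ := inferInstanceAs (IsIso (𝟙 _))
      have : Mono f.τ₃ := inferInstanceAs (Mono (kernel.ι π))
      exact (ShortComplex.exact_iff_of_epi_of_isIso_of_mono f).2 h
    obtain ⟨L, ψ, hψ, hL⟩ := ih (fun e => K (e + 1)) (fun e => δ (e + 1)) (kernel π) δ' hδ''
      (fun e => hδ (e + 1)) exδ' (fun e => exδ (e + 1)) (fun e he => hK (e + 1) (by lia))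
    let S : ShortComplex (CochainComplex C ℤ) := ShortComplex.mk (kernel.ι π) π (kernel.condition π)
    have hS : S.ShortExact := { exact := ShortComplex.exact_kernel π }
    refine ⟨mappingCone (ψ ≫ kernel.ι π),
      mappingCone.map (ψ ≫ kernel.ι π) (kernel.ι π) ψ (𝟙 _) (by simp) ≫
        mappingCone.descShortComplex S, ?_, ?_⟩
    · have := quasiIso_mappingCone_map (ψ ≫ kernel.ι π) (kernel.ι π) ψ (𝟙 _) (by simp)
      have := mappingCone.quasiIso_descShortComplex hS
      exact quasiIso_comp _ (mappingCone.descShortComplex S)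
    · intro q _ h₀ h₁ n hn
      refine q.prop_of_iso
        (HomologicalComplex.homotopyCofiber.XIsoBiprod (ψ ≫ kernel.ι π) n (n + 1) rfl).symm
        (h₁ _ _ (hL q h₀ h₁ (n + 1) fun e => ?_) (by simpa using hn 0))
      have := hn (e + 1)
      rwa [Nat.cast_add, Nat.cast_one, add_comm (e : ℤ), ← add_assoc] at this

end IteratedCone

/-! ### The word complex of a finite group -/

namespace WordComplex

section Equivariance
variable {X : Type*} (σ : Equiv.Perm X)

/-- The action of a permutation on words. -/
def mapWord (w : List (Finset X)) : List (Finset X) := w.map (Finset.map σ.toEmbedding)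

theorem mapWord_injective : Function.Injective (mapWord σ) :=
  List.map_injective_iff.2 (Finset.map_injective _)

/-- The action of a permutation on linear combinations of words. -/
def mapChains : Chains X →ₗ[ℤ] Chains X := Finsupp.lmapDomain ℤ ℤ (mapWord σ)

theorem mapChains_single (w : List (Finset X)) :
    mapChains σ (Finsupp.single w 1) = Finsupp.single (mapWord σ w) 1 := by
  simp [mapChains]

theorem mapChains_cons (S : Finset X) (c : Chains X) :
    mapChains σ (cons S c) = cons (S.map σ.toEmbedding) (mapChains σ c) := by
  suffices h : mapChains σ ∘ₗ cons S = cons (S.map σ.toEmbedding) ∘ₗ mapChains σ from congr($h c)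
  refine chains_hom_ext fun w => ?_
  simp [cons_single, mapChains_single, mapWord]

variable [DecidableEq X]

theorem mapChains_dLetter (S : Finset X) (c : Chains X) :
    mapChains σ (dLetter S c) = dLetter (S.map σ.toEmbedding) (mapChains σ c) := by
  rw [dLetter_apply, dLetter_apply, map_add, map_sum, Finset.card_map, apply_ite (mapChains σ),
    map_zero]
  congr 1
  refine Finset.sum_bij' (fun A _ => A.map σ.toEmbedding) (fun A _ => A.map σ.symm.toEmbedding)
    ?_ ?_ ?_ ?_ ?_
  · intro A hA
    rw [mem_parts] at hA ⊢
    refine ⟨Finset.map_subset_map.2 hA.1, ?_, ?_⟩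
    · simpa using hA.2.1
    · simpa using hA.2.2
  · intro A hA
    rw [mem_parts] at hA ⊢
    have h : S = (S.map σ.toEmbedding).map σ.symm.toEmbedding := by
      simp [Finset.map_map]
    refine ⟨?_, ?_, ?_⟩
    · rw [h]
      exact Finset.map_subset_map.2 hA.1
    · simpa using hA.2.1
    · rw [h]
      simpa using hA.2.2
  · intro A _
    simp [Finset.map_map]
  · intro A _
    simp [Finset.map_map]
  · intro A _
    rw [mapChains_cons, mapChains_cons, Finset.map_sdiff]

theorem mapChains_d (c : Chains X) : mapChains σ (d c) = d (mapChains σ c) := by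
  suffices h : mapChains σ ∘ₗ d = d ∘ₗ mapChains σ from congr($h c)
  refine chains_hom_ext fun w => ?_
  induction w with
  | nil => simp [d_single, mapChains_single, mapWord, dWord]
  | cons S w ih =>
    simp only [LinearMap.comp_apply] at ih ⊢
    rw [← cons_single, d_cons, map_sub, mapChains_dLetter, mapChains_cons, mapChains_cons, ih,
      d_cons]

theorem isWord_mapWord {U : Finset X} {n : ℤ} {w : List (Finset X)} (hw : IsWord U n w) :
    IsWord (U.map σ.toEmbedding) n (mapWord σ w) := by
  induction w generalizing U n with
  | nil => exact hw
  | cons S w ih =>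
    refine ⟨Finset.map_nonempty.2 hw.1, Finset.map_subset_map.2 hw.2.1, ?_⟩
    rw [Finset.card_map, ← Finset.map_sdiff]
    exact ih hw.2.2

theorem finite_isWord (U : Finset X) (n : ℤ) : {w | IsWord U n w}.Finite := by
  induction hk : U.card using Nat.strong_induction_on generalizing U n with
  | h k ih =>
    have h₁ : {w | IsWord U n w} ⊆ {[]} ∪ ⋃ S ∈ (U.powerset.erase ∅ : Finset (Finset X)),
        List.cons S '' {w | IsWord (U \ S) (n - (2 * S.card - 1)) w} := by
      rintro (_ | ⟨S, w⟩) hw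
      · simp
      · simp only [Set.mem_union, Set.mem_iUnion]
        exact Or.inr ⟨S, by simp [hw.1.ne_empty, hw.2.1], w, hw.2.2, rfl⟩
    refine Set.Finite.subset (Set.Finite.union (Set.finite_singleton _)
      (Set.Finite.biUnion (Finset.finite_toSet _) fun S hS => Set.Finite.image _ ?_)) h₁
    simp only [Finset.coe_erase, Finset.coe_powerset, Set.mem_sdiff, Set.mem_preimage,
      Set.mem_powerset_iff, Finset.coe_subset, Set.mem_singleton_iff] at hS
    have h₂ : (U \ S).card < k := by
      rw [← hk]
      exact Finset.card_lt_card (Finset.sdiff_ssubset hS.1 (Finset.nonempty_iff_ne_empty.2 hS.2))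
    exact ih _ h₂ _ _ rfl

theorem IsWord.le_two_mul_card {U : Finset X} {n : ℤ} {w : List (Finset X)} (hw : IsWord U n w) :
    n ≤ 2 * U.card := by
  induction w generalizing U n with
  | nil =>
    obtain rfl : n = 0 := hw
    positivity
  | cons S w ih =>
    have h₁ := ih hw.2.2
    have h₂ := Finset.card_sdiff_add_card_eq_card hw.2.1
    lia

theorem IsWord.nonneg {U : Finset X} {n : ℤ} {w : List (Finset X)} (hw : IsWord U n w) : 0 ≤ n := by
  induction w generalizing U n with
  | nil => exact hw.ge
  | cons S w ih =>
    have h₁ := ih hw.2.2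
    have h₂ := hw.1.card_pos
    lia

theorem IsWord.eq_nil {U : Finset X} {w : List (Finset X)} (hw : IsWord U 0 w) : w = [] := by
  cases w with
  | nil => rfl
  | cons S w =>
    have h₁ := hw.2.2.nonneg
    have h₂ := hw.1.card_pos
    lia

theorem IsWord.eq_singleton {U : Finset X} {w : List (Finset X)} (hw : IsWord U 1 w) :
    ∃ x, w = [{x}] := by
  cases w with
  | nil => exact absurd (show (1 : ℤ) = 0 from hw) one_ne_zero
  | cons S w =>
    have h₁ := hw.2.2.nonneg
    have h₂ := hw.1.card_pos
    have h₃ : S.card = 1 := by lia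
    obtain ⟨x, rfl⟩ := Finset.card_eq_one.1 h₃
    have h₄ := hw.2.2
    simp only [Finset.card_singleton, Nat.cast_one, mul_one] at h₄
    norm_num at h₄
    exact ⟨x, by rw [h₄.eq_nil]⟩

end Equivariance

section GSets
variable (G : Type v) [Fintype G] [DecidableEq G]

/-- The `G`-set of the words of degree `n` in subsets of `G`, on which `G` acts by translations. -/
@[ext]
structure Words (n : ℕ) : Type v where
  /-- The underlying word. -/
  val : List (Finset G)
  isWord : IsWord Finset.univ (n : ℤ) val

instance (n : ℕ) : Finite (Words G n) := by
  have := (finite_isWord (Finset.univ : Finset G) n).to_subtype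
  exact Finite.of_injective (fun w => (⟨w.val, w.isWord⟩ : {w | IsWord (Finset.univ : Finset G) n w}))
    fun w w' h => Words.ext (congr_arg Subtype.val h)

instance (n : ℕ) : Fintype (Words G n) := Fintype.ofFinite _

instance (n : ℕ) : DecidableEq (Words G n) := fun w w' => decidable_of_iff (w.val = w'.val)
  (Words.ext_iff).symm

variable {G}

theorem isEmpty_words {n : ℕ} (hn : 2 * Fintype.card G < n) : IsEmpty (Words G n) :=
  ⟨fun w => by
    have := w.isWord.le_two_mul_card
    rw [Finset.card_univ] at this
    lia⟩

/-- A linear combination of words of degree `n` is determined by its coefficients. -/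
theorem sum_words {n : ℕ} {c : Chains G} (hc : c ∈ wordSpan Finset.univ (n : ℤ))
    (f : Chains G →ₗ[ℤ] Chains G) :
    f c = ∑ w : Words G n, c w.val • f (Finsupp.single w.val 1) := by
  have h₁ : c = ∑ w : Words G n, c w.val • Finsupp.single w.val 1 := by
    ext w
    by_cases hw : IsWord Finset.univ (n : ℤ) w
    · rw [Finsupp.finsetSum_apply, Finset.sum_eq_single (⟨w, hw⟩ : Words G n)]
      · simp
      · intro w' _ h
        have : w'.val ≠ w := fun h' => h (Words.ext h')
        simp [this]
      · simp
    · rw [Finsupp.finsetSum_apply, Finset.sum_eq_zero]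
      · by_contra h
        exact hw (hc (Finsupp.mem_support_iff.2 h))
      · intro w' _
        have : w'.val ≠ w := fun h' => hw (h' ▸ w'.isWord)
        simp [this]
  conv_lhs => rw [h₁, map_sum]
  simp only [map_smul]

theorem single_mem_univ {n : ℕ} (w : Words G n) :
    Finsupp.single w.val 1 ∈ wordSpan (Finset.univ : Finset G) (n : ℤ) := single_mem_wordSpan w.isWord

/-- The matrix of the differential. -/
def dCoeff (n : ℕ) (w : Words G (n + 1)) (w' : Words G n) : ℤ := d (Finsupp.single w.val 1) w'.val

theorem dCoeff_mul_dCoeff (n : ℕ) (w : Words G (n + 2)) (w'' : Words G n) :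
    ∑ w' : Words G (n + 1), dCoeff (n + 1) w w' * dCoeff n w' w'' = 0 := by
  have h₁ := sum_words (n := n + 1) (d_mem_wordSpan (m := ((n + 1 : ℕ) : ℤ)) (by push_cast; ring)
    (single_mem_univ w)) d
  rw [d_d] at h₁
  have h₂ := congr($h₁ w''.val)
  rw [Finsupp.finsetSum_apply] at h₂
  exact h₂.symm

variable [Group G]

instance (n : ℕ) : MulAction G (Words G n) where
  smul g w := ⟨mapWord (MulAction.toPerm g) w.val, by
    have h := isWord_mapWord (MulAction.toPerm g) w.isWord
    rwa [Finset.map_univ_equiv] at h⟩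
  one_smul w := Words.ext (by
    change mapWord (MulAction.toPerm (1 : G)) w.val = w.val
    simp only [mapWord, MulAction.toPerm_one]
    exact (List.map_congr_left fun S _ => Finset.map_refl).trans (List.map_id _))
  mul_smul g g' w := Words.ext (by
    change mapWord (MulAction.toPerm (g * g')) w.val =
      mapWord (MulAction.toPerm g) (mapWord (MulAction.toPerm g') w.val)
    simp only [mapWord, List.map_map]
    refine List.map_congr_left fun S _ => ?_
    simp only [Function.comp_apply, Finset.map_map]
    congr 1
    ext x
    simp [mul_assoc])

theorem Words.val_smul {n : ℕ} (g : G) (w : Words G n) :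
    (g • w).val = mapWord (MulAction.toPerm g) w.val := rfl

/-- The words of degree `1` are the letters `{x}`, and `G` acts freely on them. -/
theorem words_one_free (g : G) (w : Words G 1) (h : g • w = w) : g = 1 := by
  obtain ⟨w, hw⟩ := w
  obtain ⟨x, rfl⟩ := hw.eq_singleton
  have h' := congr_arg Words.val h
  rw [Words.val_smul] at h'
  simpa [mapWord] using h'

instance : Unique (Words G 0) where
  default := ⟨[], rfl⟩
  uniq w := Words.ext w.isWord.eq_nil

/-- The matrix of the contracting homotopy. -/
def hCoeff (n : ℕ) (w : Words G n) (w' : Words G (n + 1)) : ℤ := h 1 (Finsupp.single w.val 1) w'.val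

theorem dCoeff_smul (n : ℕ) (g : G) (w : Words G (n + 1)) (w' : Words G n) :
    dCoeff n (g • w) (g • w') = dCoeff n w w' := by
  rw [dCoeff, Words.val_smul, Words.val_smul, ← mapChains_single, ← mapChains_d]
  exact Finsupp.mapDomain_apply (mapWord_injective _) _ _

/-- The matrix form of the homotopy identity, for the contracting homotopy at `1 : G`. -/
theorem dCoeff_mul_hCoeff (n : ℕ) (w w'' : Words G (n + 1)) :
    ∑ w' : Words G n, dCoeff n w w' * hCoeff n w' w'' +
      ∑ w' : Words G (n + 2), hCoeff (n + 1) w w' * dCoeff (n + 1) w' w'' =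
      if w = w'' then 1 else 0 := by
  have h₁ := sum_words (n := n) (d_mem_wordSpan (m := n) (by push_cast; ring)
    (single_mem_univ w)) (h 1)
  have h₂ := sum_words (n := n + 2) (h_mem_wordSpan (a := (1 : G)) (Finset.mem_univ _)
    (m := ((n + 2 : ℕ) : ℤ)) (by push_cast; ring) (single_mem_univ w)) d
  have h₃ := d_h_add_h_d (a := (1 : G)) (single_mem_univ w)
  rw [h₁, h₂] at h₃
  have h₄ := congr($h₃ w''.val)
  rw [Finsupp.add_apply, Finsupp.finsetSum_apply, Finsupp.finsetSum_apply, add_comm] at h₄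
  refine Eq.trans h₄ ?_
  rw [Finsupp.single_apply]
  exact if_congr Words.ext_iff.symm rfl rfl

theorem hCoeff_mul_dCoeff_zero (w w'' : Words G 0) :
    ∑ w' : Words G 1, hCoeff 0 w w' * dCoeff 0 w' w'' = 1 := by
  have h₂ := sum_words (n := 1) (h_mem_wordSpan (a := (1 : G)) (Finset.mem_univ _)
    (m := ((1 : ℕ) : ℤ)) (by simp) (single_mem_univ w)) d
  have h₃ := d_h_add_h_d (a := (1 : G)) (single_mem_univ w)
  obtain rfl : w = ⟨[], rfl⟩ := Subsingleton.elim _ _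
  obtain rfl : w'' = ⟨[], rfl⟩ := Subsingleton.elim _ _
  have h₁ : d (Finsupp.single ([] : List (Finset G)) 1) = 0 := by simp [d_single, dWord]
  rw [h₁, map_zero, add_zero] at h₃
  rw [h₂] at h₃
  have h₄ := congr($h₃ ([] : List (Finset G)))
  rw [Finsupp.finsetSum_apply] at h₄
  refine Eq.trans h₄ ?_
  simp

end GSets

end WordComplex

/-! ### Tensoring with permutation modules -/

theorem FGModuleCat.exact_of_forall {A : Type*} [Ring A] [IsNoetherianRing A]
    (S : ShortComplex (FGModuleCat.{v} A))
    (h : ∀ x : S.X₂, S.g.hom.hom x = 0 → ∃ y : S.X₁, S.f.hom.hom y = x) : S.Exact := by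
  rw [← ShortComplex.exact_map_iff_of_faithful S (forget₂ (FGModuleCat A) (ModuleCat.{v} A)),
    ShortComplex.moduleCat_exact_iff]
  exact h

theorem FGModuleCat.epi_of_surjective {A : Type*} [Ring A] [IsNoetherianRing A]
    {M N : FGModuleCat.{v} A} (f : M ⟶ N) (h : Function.Surjective f.hom.hom) : Epi f :=
  (forget₂ (FGModuleCat A) (ModuleCat.{v} A)).epi_of_epi_map ((ModuleCat.epi_iff_surjective _).2 h)

theorem FGModuleCat.subsingleton_of_isZero {A : Type*} [Ring A] {M : FGModuleCat.{v} A}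
    (h : IsZero M) : Subsingleton M :=
  ⟨fun x y => by
    have h₁ : 𝟙 M = 0 := h.eq_of_src _ _
    have h₂ : ∀ x : M, x = 0 := fun x => congr(($h₁).hom.hom x)
    rw [h₂ x, h₂ y]⟩

theorem isZero_diag_of_isEmpty {R : Type u} [CommRing R] {G : Type v} [Group G] [Finite G]
    (X : Type v) [MulAction G X] [IsEmpty X] (M : FGRep R G) :
    IsZero (FGModuleCat.of (MonoidAlgebra R G) (Diag R G X M)) := by
  rw [IsZero.iff_id_eq_zero]
  ext x
  exact Diag.ext fun y => isEmptyElim y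

section PermProp
variable (R : Type u) [CommRing R] (G : Type v) [Group G]

/-- The modules `R(A)`, for `A` a finite free `G`-set, as a property of objects of `FGRep R G`. -/
def freePermProp : ObjectProperty (FGRep R G) := fun M => IsFreePermutationModule R G M

variable {R G}

instance : (permProp R G).IsClosedUnderIsomorphisms where
  of_iso e h := IsPermutationModule.of_equiv (FGModuleCat.isoToLinearEquiv e.symm) h

instance : (freePermProp R G).IsClosedUnderIsomorphisms where
  of_iso e h := IsFreePermutationModule.of_equiv (FGModuleCat.isoToLinearEquiv e.symm) h

theorem freePermProp_of_isZero {M : FGRep R G} (h : IsZero M) : freePermProp R G M := by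
  have := FGModuleCat.subsingleton_of_isZero h
  exact isFreePermutationModule_of_subsingleton

theorem permProp_of_isZero {M : FGRep R G} (h : IsZero M) : permProp R G M :=
  (freePermProp_of_isZero h).isPermutationModule

end PermProp

section DiagFunctor
variable (R : Type u) [CommRing R] {G : Type v} [Group G] [Finite G]

/-- The functor `M ↦ R(X) ⊗ M`. -/
def diagFunctor (X : Type v) [MulAction G X] [Finite X] : FGRep R G ⥤ FGRep R G where
  obj M := FGModuleCat.of _ (Diag R G X M)
  map f := FGModuleCat.ofHom (Diag.map f.hom.hom)

instance (X : Type v) [MulAction G X] [Finite X] : (diagFunctor R (G := G) X).Additive where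

/-- The natural transformation between the functors `diagFunctor` that is given by an integral matrix
that is invariant under `G`. -/
def diagTrans {X Y : Type v} [MulAction G X] [MulAction G Y] [Fintype X] [Finite Y]
    (c : X → Y → ℤ) (hc : ∀ (g : G) x y, c (g • x) (g • y) = c x y) :
    diagFunctor R (G := G) X ⟶ diagFunctor R Y where
  app M := FGModuleCat.ofHom (Diag.matrix c hc)
  naturality M N f := by
    ext x
    refine Diag.ext fun y => ?_
    change ∑ x', c x' y • f.hom.hom (Diag.toFun x x') = f.hom.hom (∑ x', c x' y • Diag.toFun x x')
    simp

/-- A trivial one-point set gives the identity functor. -/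
def diagUnique (X : Type v) [MulAction G X] [Unique X] : diagFunctor R (G := G) X ≅ 𝟭 _ :=
  NatIso.ofComponents (fun M => LinearEquiv.toFGModuleCatIso
    (linearEquivOfSingle (Diag.toFun.trans (AddEquiv.piUnique fun _ : X => M)) (by
      intro g c f
      change Diag.toFun (MonoidAlgebra.single g c • f) default = _ • Diag.toFun f default
      rw [Diag.single_smul, Subsingleton.elim (g⁻¹ • default) (default : X)]))) (by
    intro M N f
    ext x
    rfl)

variable {R}

section
variable {X Y Z : Type v} [MulAction G X] [MulAction G Y] [MulAction G Z] [Fintype X] [Fintype Y]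
  [Fintype Z] (c : X → Y → ℤ) (hc : ∀ (g : G) x y, c (g • x) (g • y) = c x y)
  (c' : Y → Z → ℤ) (hc' : ∀ (g : G) x y, c' (g • x) (g • y) = c' x y)

theorem diagTrans_comp_eq_zero (h : ∀ x z, ∑ y, c x y * c' y z = 0) :
    diagTrans R c hc ≫ diagTrans R c' hc' = 0 := by
  ext M f
  refine Diag.ext fun z => ?_
  change ∑ y, c' y z • ∑ x, c x y • Diag.toFun (show Diag R G X M from f) x = 0
  simp only [Finset.smul_sum, smul_smul]
  rw [Finset.sum_comm]
  refine Finset.sum_eq_zero fun x _ => ?_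
  simp only [mul_comm (c' _ _), ← Finset.sum_smul, h, zero_smul]

/-- A contracting homotopy given by integral matrices, not necessarily invariant, shows exactness. -/
theorem diagTrans_exact [DecidableEq Y] (w : diagTrans R c hc ≫ diagTrans R c' hc' = 0)
    (s : Y → X → ℤ) (s' : Z → Y → ℤ)
    (h : ∀ y y', ∑ z, c' y z * s' z y' + ∑ x, s y x * c x y' = if y = y' then 1 else 0)
    (M : FGRep R G) [IsNoetherianRing R] :
    (ShortComplex.mk ((diagTrans R c hc).app M) ((diagTrans R c' hc').app M)
      (by rw [← NatTrans.comp_app, w]; rfl)).Exact := by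
  refine FGModuleCat.exact_of_forall _ fun (f : Diag R G Y M) hf => ?_
  have hf' : ∀ z, ∑ y, c' y z • Diag.toFun f y = 0 := fun z => congr_fun hf z
  let f' : Diag R G X M := Diag.toFun.symm fun x => ∑ y, s y x • Diag.toFun f y
  refine ⟨f', Diag.ext fun y' => ?_⟩
  change ∑ x, c x y' • ∑ y, s y x • Diag.toFun f y = Diag.toFun f y'
  have h₁ : ∑ x, c x y' • ∑ y, s y x • Diag.toFun f y =
      ∑ y, (∑ x, s y x * c x y') • Diag.toFun f y := by
    simp only [Finset.smul_sum, smul_smul, Finset.sum_smul]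
    rw [Finset.sum_comm]
    simp only [mul_comm]
  have h₂ : ∑ y, (∑ z, c' y z * s' z y') • Diag.toFun f y = 0 := by
    simp only [Finset.sum_smul]
    rw [Finset.sum_comm]
    refine Finset.sum_eq_zero fun z _ => ?_
    simp only [mul_comm (c' _ _), mul_smul, ← Finset.smul_sum, hf', smul_zero]
  rw [h₁, ← zero_add (∑ y, _), ← h₂, ← Finset.sum_add_distrib]
  simp only [← add_smul, h, ite_smul, one_smul, zero_smul]
  simp

theorem diagTrans_epi [DecidableEq Y] (s : Y → X → ℤ)
    (h : ∀ y y', ∑ x, s y x * c x y' = if y = y' then 1 else 0)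
    (M : FGRep R G) [IsNoetherianRing R] : Epi ((diagTrans R c hc).app M) := by
  refine FGModuleCat.epi_of_surjective _ fun (f : Diag R G Y M) => ?_
  let f' : Diag R G X M := Diag.toFun.symm fun x => ∑ y, s y x • Diag.toFun f y
  refine ⟨f', Diag.ext fun y' => ?_⟩
  change ∑ x, c x y' • ∑ y, s y x • Diag.toFun f y = Diag.toFun f y'
  simp only [Finset.smul_sum, smul_smul]
  rw [Finset.sum_comm]
  simp only [mul_comm (c _ _), ← Finset.sum_smul, h, ite_smul, one_smul, zero_smul]
  simp

end

variable [IsNoetherianRing R]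

/-- The underlying module of a biproduct is the product. -/
def biprodEquiv (M N : FGRep R G) : (M ⊞ N : FGRep R G) ≃ₗ[MonoidAlgebra R G] M × N where
  toFun x := ((biprod.fst : M ⊞ N ⟶ M).hom.hom x, (biprod.snd : M ⊞ N ⟶ N).hom.hom x)
  map_add' x y := by simp
  map_smul' r x := by simp
  invFun y := (biprod.inl : M ⟶ M ⊞ N).hom.hom y.1 + (biprod.inr : N ⟶ M ⊞ N).hom.hom y.2
  left_inv x := congr(($(biprod.total (X := M) (Y := N))).hom.hom x)
  right_inv y := by
    have h₁ : ∀ y, (biprod.fst : M ⊞ N ⟶ M).hom.hom ((biprod.inl : M ⟶ M ⊞ N).hom.hom y) = y :=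
      fun y => congr(($(biprod.inl_fst (X := M) (Y := N))).hom.hom y)
    have h₂ : ∀ y, (biprod.snd : M ⊞ N ⟶ N).hom.hom ((biprod.inl : M ⟶ M ⊞ N).hom.hom y) = 0 :=
      fun y => congr(($(biprod.inl_snd (X := M) (Y := N))).hom.hom y)
    have h₃ : ∀ y, (biprod.fst : M ⊞ N ⟶ M).hom.hom ((biprod.inr : N ⟶ M ⊞ N).hom.hom y) = 0 :=
      fun y => congr(($(biprod.inr_fst (X := M) (Y := N))).hom.hom y)
    have h₄ : ∀ y, (biprod.snd : M ⊞ N ⟶ N).hom.hom ((biprod.inr : N ⟶ M ⊞ N).hom.hom y) = y :=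
      fun y => congr(($(biprod.inr_snd (X := M) (Y := N))).hom.hom y)
    ext
    · simp only [map_add, h₁, h₃, add_zero]
    · simp only [map_add, h₂, h₄, zero_add]

theorem permProp_biprod (M N : FGRep R G) (hM : permProp R G M) (hN : permProp R G N) :
    permProp R G (M ⊞ N) :=
  IsPermutationModule.of_equiv (biprodEquiv M N) (IsPermutationModule.prod hM hN)

theorem freePermProp_biprod (M N : FGRep R G) (hM : freePermProp R G M) (hN : freePermProp R G N) :
    freePermProp R G (M ⊞ N) :=
  IsFreePermutationModule.of_equiv (biprodEquiv M N) (IsFreePermutationModule.prod hM hN)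

end DiagFunctor

/-! ### Free resolutions of complexes of permutation modules -/

section WordResolution
variable (R : Type u) [CommRing R] {G : Type v} [Group G] [Fintype G] [DecidableEq G]

open WordComplex

/-- The differential of the word complex. -/
def wordTrans (n : ℕ) : diagFunctor R (G := G) (Words G (n + 1)) ⟶ diagFunctor R (Words G n) :=
  diagTrans R (dCoeff n) (dCoeff_smul n)

theorem wordTrans_comp (n : ℕ) : wordTrans R (G := G) (n + 1) ≫ wordTrans R n = 0 :=
  diagTrans_comp_eq_zero _ _ _ _ (dCoeff_mul_dCoeff n)

/-- The augmentation of the word complex. -/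
def wordAug : diagFunctor R (G := G) (Words G 1) ⟶ 𝟭 (FGRep R G) :=
  wordTrans R 0 ≫ (diagUnique R (Words G 0)).hom

theorem wordTrans_comp_wordAug : wordTrans R (G := G) 1 ≫ wordAug R = 0 := by
  rw [wordAug, ← assoc, wordTrans_comp, zero_comp]

variable {R} [IsNoetherianRing R]

theorem wordTrans_exact (n : ℕ) (M : FGRep R G) :
    (ShortComplex.mk ((wordTrans R (n + 1)).app M) ((wordTrans R n).app M)
      (by rw [← NatTrans.comp_app, wordTrans_comp]; rfl)).Exact :=
  diagTrans_exact _ _ _ _ (wordTrans_comp R n) (hCoeff (n + 1)) (hCoeff n) (dCoeff_mul_hCoeff n) M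

theorem wordAug_exact (M : FGRep R G) :
    (ShortComplex.mk ((wordTrans R 1).app M) ((wordAug R).app M)
      (by rw [← NatTrans.comp_app, wordTrans_comp_wordAug]; rfl)).Exact := by
  let f : ShortComplex.mk ((wordTrans R 1).app M) ((wordTrans R 0).app M)
      (by rw [← NatTrans.comp_app, wordTrans_comp]; rfl) ⟶
      ShortComplex.mk ((wordTrans R 1).app M) ((wordAug R).app M)
      (by rw [← NatTrans.comp_app, wordTrans_comp_wordAug]; rfl) :=
    { τ₁ := 𝟙 _
      τ₂ := 𝟙 _
      τ₃ := (diagUnique R (Words G 0)).hom.app M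
      comm₁₂ := by simp
      comm₂₃ := by simp [wordAug] }
  have : Epi f.τ₁ := inferInstanceAs (Epi (𝟙 _))
  have : IsIso f.τ₂ := inferInstanceAs (IsIso (𝟙 _))
  have : Mono f.τ₃ := inferInstanceAs (Mono ((diagUnique R (Words G 0)).hom.app M))
  exact (ShortComplex.exact_iff_of_epi_of_isIso_of_mono f).1 (wordTrans_exact 0 M)

instance epi_wordAug (M : FGRep R G) : Epi ((wordAug R).app M) := by
  have : Epi ((wordTrans R 0).app M) := diagTrans_epi _ _ (hCoeff 0) (fun w w' => by
    rw [hCoeff_mul_dCoeff_zero, if_pos (Subsingleton.elim _ _)]) M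
  exact inferInstanceAs (Epi ((wordTrans R 0).app M ≫ (diagUnique R (Words G 0)).hom.app M))

/-- Every bounded complex of permutation modules receives a quasi-isomorphism from a complex of
permutation modules in which there is one more free term: the terms of the iterated mapping cone of the
word resolution are sums of modules `R(W_{e+1}) ⊗ Y^{n+e}`, where `W_1` is free, so that those with
`e = 0` are free and those with `e > 0` only involve terms of `Y` in degrees `> n`. -/
theorem exists_quasiIso_freePermProp {R : Type u} [CommRing R] {G : Type v} [Group G] [Finite G]
    [IsNoetherianRing R] (Y : CochainComplex (FGRep R G) ℤ)
    (hY : boundedComplex _ Y) (hY' : ∀ j, permProp R G (Y.X j)) (k : ℤ)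
    (hk : ∀ j, k < j → freePermProp R G (Y.X j)) :
    ∃ (L : CochainComplex (FGRep R G) ℤ) (ψ : L ⟶ Y), QuasiIso ψ ∧ boundedComplex _ L ∧
      (∀ j, permProp R G (L.X j)) ∧ ∀ j, k ≤ j → freePermProp R G (L.X j) := by
  classical
  have := Fintype.ofFinite G
  -- `W e` is tensoring with `R(W_e)`, and `W 0` is isomorphic to the identity.
  let W (e : ℕ) := (diagFunctor R (G := G) (Words G e)).mapHomologicalComplex (.up ℤ)
  let π : (W 1).obj Y ⟶ Y := (NatTrans.mapHomologicalComplex (wordAug R) (.up ℤ)).app Y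
  let δ (e : ℕ) : (W (e + 1)).obj Y ⟶ (W e).obj Y :=
    (NatTrans.mapHomologicalComplex (wordTrans R e) (.up ℤ)).app Y
  have hπ : δ 1 ≫ π = 0 := by
    ext n : 1
    exact NatTrans.congr_app (wordTrans_comp_wordAug R) (Y.X n)
  have hδ (e : ℕ) : δ (e + 1) ≫ δ e = 0 := by
    ext n : 1
    exact NatTrans.congr_app (wordTrans_comp R e) (Y.X n)
  have : Epi π := by
    have (n : ℤ) : Epi (π.f n) := epi_wordAug (Y.X n)
    exact HomologicalComplex.epi_of_epi_f _ inferInstance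
  have hW {e : ℕ} (he : 2 * Fintype.card G ≤ e) (j : ℤ) : IsZero (((W (e + 1)).obj Y).X j) := by
    have := isEmpty_words (G := G) (show 2 * Fintype.card G < e + 1 by lia)
    exact isZero_diag_of_isEmpty _ _
  obtain ⟨L, ψ, hψ, hL⟩ := exists_quasiIso_of_resolution (2 * Fintype.card G)
    (fun e => (W (e + 1)).obj Y) (fun e => δ (e + 1)) Y π hπ (fun e => hδ (e + 1))
    (HomologicalComplex.exact_of_degreewise_exact _ fun n => wordAug_exact (Y.X n))
    (fun e => HomologicalComplex.exact_of_degreewise_exact _ fun n => wordTrans_exact _ (Y.X n))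
    (fun e he => by
      rw [IsZero.iff_id_eq_zero]
      ext j : 1
      exact (hW he j).eq_of_src _ _)
  refine ⟨L, ψ, hψ, ?_, ?_, ?_⟩
  · obtain ⟨⟨a, _⟩, ⟨b, _⟩⟩ := hY
    refine ⟨⟨a - 2 * Fintype.card G, ?_⟩, ⟨b, ?_⟩⟩
    · rw [CochainComplex.isStrictlyGE_iff]
      intro n hn
      refine hL IsZero (fun _ h => h) (fun _ _ h h' => (biprod_isZero_iff _ _).2 ⟨h, h'⟩) n fun e => ?_
      by_cases he : 2 * Fintype.card G ≤ e
      · exact hW he _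
      · exact (diagFunctor R (Words G (e + 1))).map_isZero (Y.isZero_of_isStrictlyGE a (n + e) (by lia))
    · rw [CochainComplex.isStrictlyLE_iff]
      intro n hn
      exact hL IsZero (fun _ h => h) (fun _ _ h h' => (biprod_isZero_iff _ _).2 ⟨h, h'⟩) n fun e =>
        (diagFunctor R (Words G (e + 1))).map_isZero (Y.isZero_of_isStrictlyLE b (n + e) (by lia))
  · exact fun n => hL _ (fun _ => permProp_of_isZero) permProp_biprod n fun e => (hY' _).diag
  · intro n hn
    refine hL _ (fun _ => freePermProp_of_isZero) freePermProp_biprod n fun e => ?_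
    obtain _ | e := e
    · exact (hY' _).diag_of_free words_one_free
    · exact IsFreePermutationModule.diag (hk _ (by push_cast; lia))

/-- Every bounded complex of permutation modules admits resolutions by bounded complexes of permutation
modules that are free in all degrees above any given bound. -/
theorem exists_quasiIso_freePermProp_of_le {R : Type u} [CommRing R] {G : Type v} [Group G] [Finite G]
    [IsNoetherianRing R] (Y : CochainComplex (FGRep R G) ℤ)
    (hY : boundedComplex _ Y) (hY' : ∀ j, permProp R G (Y.X j)) (k : ℤ) :
    ∃ (L : CochainComplex (FGRep R G) ℤ) (ψ : L ⟶ Y), QuasiIso ψ ∧ boundedComplex _ L ∧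
      (∀ j, permProp R G (L.X j)) ∧ ∀ j, k ≤ j → freePermProp R G (L.X j) := by
  obtain ⟨b, _⟩ := hY.2
  suffices h : ∀ m : ℕ, ∃ (L : CochainComplex (FGRep R G) ℤ) (ψ : L ⟶ Y), QuasiIso ψ ∧
      boundedComplex _ L ∧ (∀ j, permProp R G (L.X j)) ∧
      ∀ j, b + 1 - m ≤ j → freePermProp R G (L.X j) by
    obtain ⟨L, ψ, h₁, h₂, h₃, h₄⟩ := h (b + 1 - k).toNat
    exact ⟨L, ψ, h₁, h₂, h₃, fun j hj => h₄ j (by lia)⟩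
  intro m
  induction m with
  | zero =>
    exact ⟨Y, 𝟙 Y, inferInstance, hY, hY', fun j hj =>
      freePermProp_of_isZero (Y.isZero_of_isStrictlyLE b _ (by lia))⟩
  | succ m ih =>
    obtain ⟨L, ψ, h₁, h₂, h₃, h₄⟩ := ih
    obtain ⟨L', ψ', h₁', h₂', h₃', h₄'⟩ := exists_quasiIso_freePermProp L h₂ h₃ (b + 1 - (m + 1 : ℕ))
      fun j hj => h₄ j (by lia)
    exact ⟨L', ψ' ≫ ψ, inferInstance, h₂', h₃', h₄'⟩

end WordResolution

/-! ### Morphisms from complexes with projective terms -/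

section Vanishing
variable {C : Type u} [Category.{v} C] [Abelian C]

open CochainComplex HomComplex

/-- A partial homotopy can be extended by one degree. -/
theorem exists_extension_of_projective {P A : CochainComplex C ℤ} (f : P ⟶ A)
    (α : Cochain P A (-1)) (n : ℤ) (hA : A.ExactAt n) [Projective (P.X n)]
    (hα : ∀ p, n < p → (δ (-1) 0 α).v p p (add_zero p) = f.f p) :
    ∃ β : Cochain P A (-1), ∀ p, n ≤ p → (δ (-1) 0 β).v p p (add_zero p) = f.f p := by
  let u := f.f n - α.v n (n - 1) (by lia) ≫ A.d (n - 1) n -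
    P.d n (n + 1) ≫ α.v (n + 1) n (by lia)
  have hu : u ≫ A.d n (n + 1) = 0 := by
    have eq := hα (n + 1) (by lia)
    simp only [δ_v (-1) 0 (neg_add_cancel 1) α (n + 1) (n + 1) (add_zero _) n (n + 2)
      (by lia) (by lia), Int.negOnePow_zero, one_smul] at eq
    simp only [u, Preadditive.sub_comp, assoc, A.d_comp_d, comp_zero, sub_zero, f.comm, ← eq,
      Preadditive.comp_add, P.d_comp_d_assoc, zero_comp, add_zero, sub_self]
  rw [A.exactAt_iff' (n - 1) n (n + 1) (by simp) (by simp)] at hA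
  obtain ⟨β, hβ⟩ : ∃ β : P.X n ⟶ A.X (n - 1), β ≫ A.d (n - 1) n = u :=
    ⟨hA.liftFromProjective u hu, hA.liftFromProjective_comp u hu⟩
  refine ⟨α + Cochain.single β (-1), fun p hp => ?_⟩
  obtain hp | rfl := hp.lt_or_eq
  · rw [δ_add, Cochain.add_v, hα p hp, add_eq_left,
      δ_v (-1) 0 (neg_add_cancel 1) _ p p (add_zero p) (p - 1) (p + 1) rfl rfl,
      Cochain.single_v_eq_zero _ _ _ _ _ (by lia),
      Cochain.single_v_eq_zero _ _ _ _ _ (by lia)]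
    simp
  · rw [δ_v (-1) 0 (neg_add_cancel 1) _ n n (add_zero n) (n - 1) (n + 1)
      (by lia) (by lia), Cochain.add_v, Cochain.add_v,
      Cochain.single_v_eq_zero β (-1) (n + 1) n (by lia) (by lia)]
    simp only [Cochain.single_v, hβ, Int.negOnePow_zero, one_smul,
      Preadditive.add_comp, add_zero, u]
    abel

/-- A morphism from a bounded above complex to an acyclic complex concentrated in degrees `≥ c` is
homotopic to zero as soon as the terms of its source in degrees `≥ c` are projective. -/
theorem nonempty_homotopy_zero_of_projective {P A : CochainComplex C ℤ} (f : P ⟶ A) (b c : ℤ)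
    [P.IsStrictlyLE b] (hP : ∀ j, c ≤ j → Projective (P.X j)) (hA : A.Acyclic) [A.IsStrictlyGE c] :
    Nonempty (Homotopy f 0) := by
  have h (m : ℕ) : ∃ α : Cochain P A (-1),
      ∀ p, b + 1 - m ≤ p → (δ (-1) 0 α).v p p (add_zero p) = f.f p := by
    induction m with
    | zero => exact ⟨0, fun p hp => (P.isZero_of_isStrictlyLE b p (by lia)).eq_of_src _ _⟩
    | succ m ih =>
      obtain ⟨α, hα⟩ := ih
      by_cases hc : c ≤ b - m
      · have := hP _ hc
        obtain ⟨β, hβ⟩ := exists_extension_of_projective f α (b - m) (hA _)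
          fun p hp => hα p (by lia)
        exact ⟨β, fun p hp => hβ p (by push_cast at hp; lia)⟩
      · refine ⟨α, fun p hp => ?_⟩
        by_cases hp' : b + 1 - m ≤ p
        · exact hα p hp'
        · exact (A.isZero_of_isStrictlyGE c p (by lia)).eq_of_tgt _ _
  obtain ⟨α, hα⟩ := h (b + 1 - c).toNat
  refine ⟨(Cochain.equivHomotopy f 0).symm ⟨α, ?_⟩⟩
  rw [Cochain.ofHom_zero, add_zero]
  ext p
  rw [Cochain.ofHom_v]
  by_cases hp : c ≤ p
  · exact (hα p (by lia)).symm
  · exact (A.isZero_of_isStrictlyGE c p (by lia)).eq_of_tgt _ _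

/-- If the terms of `X` in degrees `≥ c` are projective, then the morphisms in the homotopy category
from `X` to complexes concentrated in degrees `> c` are invariant under quasi-isomorphisms. -/
theorem bijective_comp_of_projective (X : CochainComplex C ℤ) (b c : ℤ) [X.IsStrictlyLE b]
    (hX : ∀ j, c ≤ j → Projective (X.X j)) {Y Z : CochainComplex C ℤ} [Y.IsStrictlyGE (c + 1)]
    [Z.IsStrictlyGE (c + 1)] (s : Y ⟶ Z) [QuasiIso s] :
    Function.Bijective fun g : (HomotopyCategory.quotient C (.up ℤ)).obj X ⟶
      (HomotopyCategory.quotient C (.up ℤ)).obj Y => g ≫ (HomotopyCategory.quotient C _).map s := by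
  have hT := HomotopyCategory.mappingCone_triangleh_distinguished s
  have hA : (mappingCone s).Acyclic := by
    rw [← HomotopyCategory.quotient_obj_mem_subcategoryAcyclic_iff_acyclic]
    refine ((HomotopyCategory.subcategoryAcyclic C).trW_iff_of_distinguished _ hT).1 ?_
    rw [← HomotopyCategory.quasiIso_eq_trW_subcategoryAcyclic]
    exact (HomotopyCategory.quotient_map_mem_quasiIso_iff s).2 (by
      rw [HomologicalComplex.mem_quasiIso_iff]
      infer_instance)
  have : (mappingCone s).IsStrictlyGE c :=
    isStrictlyGE_mappingCone s (c + 1) (c + 1) c (by lia) (by lia)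
  have hV (A : CochainComplex C ℤ) [A.IsStrictlyGE c] (hA : A.Acyclic)
      (g : (HomotopyCategory.quotient C (.up ℤ)).obj X ⟶
        (HomotopyCategory.quotient C (.up ℤ)).obj A) : g = 0 := by
    obtain ⟨g, rfl⟩ := (HomotopyCategory.quotient _ _).map_surjective g
    obtain ⟨h⟩ := nonempty_homotopy_zero_of_projective g b c hX hA
    rw [HomotopyCategory.eq_of_homotopy _ _ h, Functor.map_zero]
  constructor
  · intro g g' h
    rw [← sub_eq_zero]
    obtain ⟨k, hk⟩ := Triangle.coyoneda_exact₂ _ (inv_rot_of_distTriang _ hT) (g - g') (by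
      refine (Preadditive.sub_comp _ _ _).trans ?_
      rw [sub_eq_zero]
      exact h)
    have hA' : ((mappingCone s)⟦(-1 : ℤ)⟧).Acyclic := by
      rw [← HomotopyCategory.quotient_obj_mem_subcategoryAcyclic_iff_acyclic] at hA ⊢
      exact ObjectProperty.prop_of_iso _
        (((HomotopyCategory.quotient C (.up ℤ)).commShiftIso (-1)).symm.app (mappingCone s))
        ((HomotopyCategory.subcategoryAcyclic C).le_shift (-1) _ hA)
    have : ((mappingCone s)⟦(-1 : ℤ)⟧).IsStrictlyGE c :=
      have := (mappingCone s).isStrictlyGE_shift c (-1) (c + 1) (by lia)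
      isStrictlyGE_of_ge _ c (c + 1) (by lia)
    have hk' (K : HomotopyCategory C (.up ℤ))
        (e : K ≅ (HomotopyCategory.quotient C (.up ℤ)).obj ((mappingCone s)⟦(-1 : ℤ)⟧))
        (k : (HomotopyCategory.quotient C (.up ℤ)).obj X ⟶ K) : k = 0 := by
      rw [← cancel_mono e.hom, hV _ hA' (k ≫ e.hom), zero_comp]
    rw [hk, hk' _ (((HomotopyCategory.quotient C (.up ℤ)).commShiftIso (-1)).symm.app
      (mappingCone s)) k]
    exact zero_comp
  · intro g
    obtain ⟨k, hk⟩ := Triangle.coyoneda_exact₂ _ hT g (hV _ hA _)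
    exact ⟨k, hk.symm⟩

/-- If the terms of `X` in degrees `≥ c` are projective, then the morphisms from `X` to complexes
concentrated in degrees `> c` are the same in the homotopy category and in the derived category. -/
theorem bijective_Qh_map_of_projective [HasDerivedCategory.{w} C] (X : CochainComplex C ℤ) (b c : ℤ)
    [X.IsStrictlyLE b] (hX : ∀ j, c ≤ j → Projective (X.X j)) (Y : CochainComplex C ℤ)
    [Y.IsStrictlyGE (c + 1)] :
    Function.Bijective fun g : (HomotopyCategory.quotient C (.up ℤ)).obj X ⟶
      (HomotopyCategory.quotient C (.up ℤ)).obj Y => DerivedCategory.Qh.map g := by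
  have htr {Z : CochainComplex C ℤ} (s : Y ⟶ Z)
      (hs : HomotopyCategory.quasiIso C _ ((HomotopyCategory.quotient C (.up ℤ)).map s)) :
      ∃ (Z' : CochainComplex C ℤ) (p : Z ⟶ Z'), Z'.IsStrictlyGE (c + 1) ∧ QuasiIso (s ≫ p) := by
    rw [HomotopyCategory.quotient_map_mem_quasiIso_iff, HomologicalComplex.mem_quasiIso_iff] at hs
    have : Z.IsGE (c + 1) := (isGE_iff _ _).2 fun i hi =>
      (quasiIsoAt_iff_exactAt s i (Y.exactAt_of_isGE (c + 1) i hi)).1 inferInstance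
    exact ⟨Z.truncGE (c + 1), Z.πTruncGE (c + 1), inferInstance, inferInstance⟩
  constructor
  · intro g g' h
    obtain ⟨Z, s, hs, h'⟩ := (MorphismProperty.map_eq_iff_postcomp DerivedCategory.Qh
      (HomotopyCategory.quasiIso C _) g g').1 h
    obtain ⟨Z, rfl⟩ := HomotopyCategory.quotient_obj_surjective Z
    obtain ⟨s, rfl⟩ := (HomotopyCategory.quotient _ _).map_surjective s
    obtain ⟨Z', p, _, _⟩ := htr s hs
    apply (bijective_comp_of_projective X b c hX (s ≫ p)).1
    dsimp only
    rw [Functor.map_comp, reassoc_of% h']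
  · intro φ
    obtain ⟨ψ, hψ⟩ := Localization.exists_leftFraction DerivedCategory.Qh
      (HomotopyCategory.quasiIso C _) φ
    obtain ⟨Z, g, s, hs, rfl⟩ := ψ.cases
    obtain ⟨Z, rfl⟩ := HomotopyCategory.quotient_obj_surjective Z
    obtain ⟨s, rfl⟩ := (HomotopyCategory.quotient _ _).map_surjective s
    obtain ⟨Z', p, _, _⟩ := htr s hs
    obtain ⟨g', hg'⟩ := (bijective_comp_of_projective X b c hX (s ≫ p)).2
      (g ≫ (HomotopyCategory.quotient _ _).map p)
    refine ⟨g', ?_⟩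
    dsimp only at hg' ⊢
    have := Localization.inverts DerivedCategory.Qh (HomotopyCategory.quasiIso C (.up ℤ))
      ((HomotopyCategory.quotient C (.up ℤ)).map (s ≫ p)) (by
        rw [HomotopyCategory.quotient_map_mem_quasiIso_iff, HomologicalComplex.mem_quasiIso_iff]
        infer_instance)
    rw [hψ, ← cancel_mono (DerivedCategory.Qh.map ((HomotopyCategory.quotient C (.up ℤ)).map
      (s ≫ p))), ← Functor.map_comp, hg', Functor.map_comp, Functor.map_comp, Functor.map_comp,
      MorphismProperty.LeftFraction.map_comp_map_s_assoc]

end Vanishing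

/-! ### Full faithfulness on the Verdier quotient -/

section FullyFaithful

theorem FGModuleCat.projective_of_free {A : Type u} [Ring A] [IsNoetherianRing A]
    (M : FGModuleCat.{max u v} A) [Module.Free A M] : Projective M :=
  (forget₂ (FGModuleCat A) (ModuleCat.{max u v} A)).projective_of_map_projective
    (ModuleCat.projective_of_free (Module.Free.chooseBasis A M))

variable {R : Type u} [CommRing R] {G : Type v} [Group G]

/-- A complex of permutation modules, as a complex in the category of permutation modules. -/
def permLift (K : CochainComplex (FGRep R G) ℤ) (hK : ∀ j, permProp R G (K.X j)) :
    CochainComplex (Perm R G) ℤ where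
  X j := ⟨K.X j, hK j⟩
  d i j := ObjectProperty.homMk (K.d i j)
  shape i j hij := by
    ext : 1
    exact K.shape i j hij
  d_comp_d' i j k _ _ := by
    ext : 1
    exact K.d_comp_d i j k

variable (R G) in
/-- The inclusion of the complexes of permutation modules into the complexes of modules. -/
abbrev permIncl : CochainComplex (Perm R G) ℤ ⥤ CochainComplex (FGRep R G) ℤ :=
  (permProp R G).ι.mapHomologicalComplex (.up ℤ)

theorem boundedComplex_of_permIncl {K : CochainComplex (Perm R G) ℤ}
    (hK : boundedComplex _ ((permIncl R G).obj K)) : boundedComplex _ K := by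
  have h (j : ℤ) (hj : IsZero (((permIncl R G).obj K).X j)) : IsZero (K.X j) :=
    IsZero.of_full_of_faithful_of_isZero (permProp R G).ι _ hj
  obtain ⟨⟨a, _⟩, ⟨b, _⟩⟩ := hK
  refine ⟨⟨a, (CochainComplex.isStrictlyGE_iff _ _).2 fun i hi => h i ?_⟩,
    ⟨b, (CochainComplex.isStrictlyLE_iff _ _).2 fun i hi => h i ?_⟩⟩
  · exact CochainComplex.isZero_of_isStrictlyGE _ a i hi
  · exact CochainComplex.isZero_of_isStrictlyLE _ b i hi

theorem boundedComplex_permIncl {K : CochainComplex (Perm R G) ℤ} (hK : boundedComplex _ K) :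
    boundedComplex _ ((permIncl R G).obj K) := by
  obtain ⟨⟨a, _⟩, ⟨b, _⟩⟩ := hK
  exact ⟨⟨a, inferInstance⟩, ⟨b, inferInstance⟩⟩

/-- A bounded complex of permutation modules, as an object of `K^b(perm(G;R))`. -/
abbrev Kb.mk (K : CochainComplex (Perm R G) ℤ) (hK : boundedComplex _ K) : Kb (Perm R G) :=
  ⟨(HomotopyCategory.quotient _ _).obj K, (boundedHomotopy_quotient_iff K).2 hK⟩

theorem Kb.exists_eq_mk (X : Kb (Perm R G)) : ∃ K hK, X = Kb.mk K hK := by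
  obtain ⟨X, hX⟩ := X
  obtain ⟨K, rfl⟩ := HomotopyCategory.quotient_obj_surjective X
  exact ⟨K, (boundedHomotopy_quotient_iff K).1 hX, rfl⟩

variable [Finite G] [IsNoetherianRing R]

instance : (inclK R G).Full := by
  unfold inclK
  infer_instance

instance : (inclK R G).Faithful := by
  unfold inclK
  infer_instance

theorem trW_Kbac_iff {X Y : Kb (Perm R G)} (f : X ⟶ Y) :
    (Kbac R G).trW f ↔ HomotopyCategory.quasiIso _ _ ((inclK R G).map f) := by
  rw [HomotopyCategory.quasiIso_eq_trW_subcategoryAcyclic]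
  exact ObjectProperty.inverseImage_trW_iff _ _ _

theorem VerdierQuotient.exists_eq_Q_obj (X : VerdierQuotient R G) :
    ∃ X', X = (Kbac R G).trW.Q.obj X' :=
  ⟨_, ((Localization.Construction.objEquiv _).right_inv X).symm⟩

/-- In the Verdier quotient, every object can be represented by a complex of permutation modules whose
terms are projective in all degrees above any given bound. -/
theorem exists_trW_projective (X : Kb (Perm R G)) (c : ℤ) :
    ∃ (P : CochainComplex (Perm R G) ℤ) (hP : boundedComplex _ P) (t : Kb.mk P hP ⟶ X),
      (Kbac R G).trW t ∧ ∀ j, c ≤ j → Projective (((permIncl R G).obj P).X j) := by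
  obtain ⟨K, hK, rfl⟩ := X.exists_eq_mk
  obtain ⟨L, ψ, hψ, h₁, h₂, h₃⟩ := exists_quasiIso_freePermProp_of_le ((permIncl R G).obj K)
    (boundedComplex_permIncl hK) (fun j => (K.X j).property) c
  let ψ' : permLift L h₂ ⟶ K :=
    { f j := ObjectProperty.homMk (ψ.f j)
      comm' i j _ := by
        ext : 1
        exact ψ.comm i j }
  refine ⟨permLift L h₂, boundedComplex_of_permIncl h₁,
    ObjectProperty.homMk ((HomotopyCategory.quotient _ _).map ψ'), ?_, fun j hj => ?_⟩
  · rw [trW_Kbac_iff]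
    refine (HomotopyCategory.quotient_map_mem_quasiIso_iff
      (C := FGRep R G) (c := .up ℤ) ψ).2 ?_
    rw [HomologicalComplex.mem_quasiIso_iff]
    exact hψ
  · have := (h₃ j hj).free
    exact FGModuleCat.projective_of_free.{v, max u v} (L.X j)

variable [HasDerivedCategory.{w} (FGRep R G)]

/-- On complexes with enough projective terms, `Upsilon` is fully faithful. -/
theorem bijective_Upsilon_map {P : CochainComplex (Perm R G) ℤ} (hP : boundedComplex _ P) (c : ℤ)
    (hP' : ∀ j, c ≤ j → Projective (((permIncl R G).obj P).X j))
    {Y : CochainComplex (Perm R G) ℤ} (hY : boundedComplex _ Y) [Y.IsStrictlyGE (c + 1)] :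
    Function.Bijective fun g : Kb.mk P hP ⟶ Kb.mk Y hY => (Upsilon R G).map g := by
  obtain ⟨b, _⟩ := hP.2
  have h₁ := bijective_Qh_map_of_projective ((permIncl R G).obj P) b c hP' ((permIncl R G).obj Y)
  have h₂ : Function.Bijective fun g : Kb.mk P hP ⟶ Kb.mk Y hY => (inclK R G).map g :=
    ⟨(inclK R G).map_injective, (inclK R G).map_surjective⟩
  have h₃ : Function.Bijective fun g : (Upsilon R G).obj (Kb.mk P hP) ⟶
        (Upsilon R G).obj (Kb.mk Y hY) =>
      (DerivedCategory.Bounded.ι (C := FGRep R G)).map g :=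
    ⟨Functor.map_injective _, Functor.map_surjective _⟩
  refine (Function.Bijective.of_comp_iff' h₃ _).1 ?_
  exact h₁.comp h₂

/-- The isomorphism through which `UpsilonQuotient` is induced by `Upsilon`. -/
def QCompUpsilonQuotientIso : (Kbac R G).trW.Q ⋙ UpsilonQuotient R G ≅ Upsilon R G :=
  Localization.Lifting.iso (Kbac R G).trW.Q (Kbac R G).trW (Upsilon R G) (UpsilonQuotient R G)

instance : NatTrans.CommShift (QCompUpsilonQuotientIso (R := R) (G := G)).hom ℤ :=
  NatTrans.commShift_iso_hom_of_localization _ _ _ _ _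

instance : (Upsilon R G).IsTriangulated := by
  unfold Upsilon
  infer_instance

instance : (UpsilonQuotient R G).IsTriangulated :=
  have := Localization.essSurj_mapArrow (Kbac R G).trW.Q (Kbac R G).trW
  Functor.isTriangulated_of_precomp_iso QCompUpsilonQuotientIso

/-- If `Y` is concentrated in degrees `≥ n`, then replacing `X` by a complex with projective terms in
degrees `≥ n - 1` reduces the injectivity to `bijective_Upsilon_map`. -/
instance : (UpsilonQuotient R G).Faithful := by
  refine Functor.faithful_of_comp_cancel_zero_of_hasLeftCalculusOfFractions (Kbac R G).trW.Q
    (Kbac R G).trW _ fun X Y f hf => ?_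
  obtain ⟨Y, hY, rfl⟩ := Y.exists_eq_mk
  obtain ⟨n, _⟩ := hY.1
  obtain ⟨P, hP, t, ht, hP'⟩ := exists_trW_projective X (n - 1)
  have : Y.IsStrictlyGE (n - 1 + 1) := by rwa [sub_add_cancel]
  have := Localization.inverts (Kbac R G).trW.Q (Kbac R G).trW t ht
  rw [← cancel_epi ((Kbac R G).trW.Q.map t), comp_zero, ← Functor.map_comp]
  suffices t ≫ f = 0 by rw [this, Functor.map_zero]
  apply (bijective_Upsilon_map hP (n - 1) hP' hY).1
  have h : (Upsilon R G).map f = 0 := by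
    rw [← cancel_epi (QCompUpsilonQuotientIso.hom.app X), ← NatTrans.naturality, Functor.comp_map, hf,
      zero_comp, comp_zero]
  dsimp only
  rw [Functor.map_comp, h, comp_zero, Functor.map_zero]

instance : (UpsilonQuotient R G).Full where
  map_surjective {X Y} φ := by
    obtain ⟨X, rfl⟩ := VerdierQuotient.exists_eq_Q_obj X
    obtain ⟨Y, rfl⟩ := VerdierQuotient.exists_eq_Q_obj Y
    obtain ⟨Y, hY, rfl⟩ := Y.exists_eq_mk
    obtain ⟨n, _⟩ := hY.1
    obtain ⟨P, hP, t, ht, hP'⟩ := exists_trW_projective X (n - 1)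
    have : Y.IsStrictlyGE (n - 1 + 1) := by rwa [sub_add_cancel]
    have := Localization.inverts (Kbac R G).trW.Q (Kbac R G).trW t ht
    let e := QCompUpsilonQuotientIso (R := R) (G := G)
    obtain ⟨g, hg⟩ := (bijective_Upsilon_map hP (n - 1) hP' hY).2
      ((Upsilon R G).map t ≫ e.inv.app X ≫ φ ≫ e.hom.app _)
    refine ⟨inv ((Kbac R G).trW.Q.map t) ≫ (Kbac R G).trW.Q.map g, ?_⟩
    rw [Functor.map_comp, Functor.map_inv, IsIso.inv_comp_eq, ← cancel_mono (e.hom.app _)]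
    have h₁ := e.hom.naturality g
    have h₂ := e.hom.naturality t
    have h₃ := e.hom_inv_id_app X
    dsimp only [Functor.comp_map] at h₁ h₂ hg h₃
    rw [h₁, hg, ← reassoc_of% h₂, reassoc_of% h₃, assoc]

end FullyFaithful

/-! ### Direct summands of the objects of a triangulated subcategory -/

section RetractClosure
variable {C : Type*} [Category C] [Preadditive C] [HasZeroObject C] [HasShift C ℤ]
  [∀ n : ℤ, (shiftFunctor C n).Additive] [Pretriangulated C] (A : ObjectProperty C)
  [A.IsTriangulated] [A.IsClosedUnderIsomorphisms]

/-- The direct summands of the objects of a triangulated subcategory form a triangulated subcategory: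
an extension of such summands is a summand of an extension of objects of the subcategory. -/
instance isTriangulated_retractClosure : A.retractClosure.IsTriangulated where
  exists_zero :=
    have ⟨Z, hZ, hZ'⟩ := A.exists_prop_of_containsZero
    ⟨Z, hZ, A.le_retractClosure _ hZ'⟩
  isStableUnderShiftBy n :=
    { le_shift := by
        rintro X ⟨Y, hY, ⟨r⟩⟩
        exact ⟨Y⟦n⟧, A.le_shift n _ hY, ⟨r.map (shiftFunctor C n)⟩⟩ }
  toIsTriangulatedClosed₂ := .mk' fun T hT h₁ h₃ =>
    ObjectProperty.monotone_retractClosure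
      (ObjectProperty.extensionProduct_le_of_isTriangulatedClosed₂ le_rfl le_rfl) _
      (ObjectProperty.extensionProduct_retractClosure_retractClosure_le A A _
        ⟨_, _, _, _, _, hT, h₁, h₃⟩)

/-- If `X` is a direct summand of `Y`, then `X ⊞ X⟦1⟧` is the cone of an endomorphism of `Y`, the
projection onto the complement of `X`; the complement itself need not exist as an object. -/
theorem prop_biprod_shift_of_retract {X Y : C} (e : Retract X Y) (hY : A Y) :
    A (X ⊞ X⟦(1 : ℤ)⟧) := by
  obtain ⟨i, r, hir⟩ := e
  obtain ⟨Z, g, h, hT⟩ := distinguished_cocone_triangle (𝟙 Y - r ≫ i)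
  have hZ : A Z := ObjectProperty.ext_of_isTriangulatedClosed₃ A _ hT hY hY
  obtain ⟨ρ, hρ⟩ : ∃ ρ : Z ⟶ X, r = g ≫ ρ :=
    Triangle.yoneda_exact₂ _ hT r (by
      change (𝟙 Y - r ≫ i) ≫ r = 0
      rw [Preadditive.sub_comp, id_comp, assoc, hir, comp_id, sub_self])
  obtain ⟨σ, hσ⟩ : ∃ σ : X⟦(1 : ℤ)⟧ ⟶ Z, i⟦1⟧' = σ ≫ h :=
    Triangle.coyoneda_exact₁ _ hT (i⟦1⟧') (by
      change i⟦1⟧' ≫ (𝟙 Y - r ≫ i)⟦1⟧' = 0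
      rw [← Functor.map_comp, Preadditive.comp_sub, comp_id, reassoc_of% hir, sub_self,
        Functor.map_zero])
  have hgh : g ≫ h = 0 := comp_distTriang_mor_zero₂₃ _ hT
  have hqg : (𝟙 Y - r ≫ i) ≫ g = 0 := comp_distTriang_mor_zero₁₂ _ hT
  have hhq : h ≫ (𝟙 Y - r ≫ i)⟦1⟧' = 0 := comp_distTriang_mor_zero₃₁ _ hT
  let φ : Z ⟶ X ⊞ X⟦(1 : ℤ)⟧ := biprod.lift ρ (h ≫ r⟦1⟧')
  have : Mono φ := by
    rw [Preadditive.mono_iff_cancel_zero]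
    intro U f hf
    have h₁ : f ≫ ρ = 0 := by
      have := congr($hf ≫ biprod.fst)
      simpa [φ] using this
    have h₂ : f ≫ h ≫ r⟦1⟧' = 0 := by
      have := congr($hf ≫ biprod.snd)
      simpa [φ] using this
    have h₃ : f ≫ h = 0 := by
      have h₄ : f ≫ h = (f ≫ h ≫ r⟦1⟧') ≫ i⟦1⟧' + f ≫ h ≫ (𝟙 Y - r ≫ i)⟦1⟧' := by
        simp [Functor.map_sub, Preadditive.comp_sub]
      rw [h₄, h₂, hhq, zero_comp, comp_zero, add_zero]
    obtain ⟨k, hk⟩ : ∃ k : U ⟶ Y, f = k ≫ g := Triangle.coyoneda_exact₃ _ hT f h₃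
    have h₄ : k ≫ r = 0 := by rw [hρ, ← assoc, ← hk, h₁]
    have h₅ : k ≫ g = (k ≫ r) ≫ i ≫ g + k ≫ (𝟙 Y - r ≫ i) ≫ g := by
      simp [Preadditive.sub_comp, Preadditive.comp_sub]
    rw [hk, h₅, h₄, hqg, zero_comp, comp_zero, add_zero]
  have hφ : biprod.desc (i ≫ g) (σ - σ ≫ ρ ≫ i ≫ g) ≫ φ = 𝟙 _ := by
    have h₁ : (i ≫ g) ≫ ρ = 𝟙 X := by rw [assoc, ← hρ, hir]
    have h₂ : σ ≫ h ≫ r⟦1⟧' = 𝟙 _ := by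
      rw [← reassoc_of% hσ, ← Functor.map_comp, hir, CategoryTheory.Functor.map_id]
    apply biprod.hom_ext'
    · apply biprod.hom_ext
      · simpa [φ] using h₁
      · simp [φ, reassoc_of% hgh]
    · apply biprod.hom_ext
      · rw [assoc] at h₁
        simp [φ, Preadditive.sub_comp, h₁]
      · simp [φ, Preadditive.sub_comp, reassoc_of% hgh, h₂]
  have : IsSplitEpi φ := ⟨⟨⟨_, hφ⟩⟩⟩
  have : IsIso φ := isIso_of_mono_of_isSplitEpi φ
  exact A.prop_of_iso (asIso φ) hZ

/-- The objects `X` for which `X ⊞ X⟦1⟧` belongs to a triangulated subcategory are the direct summands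
of its objects. -/
theorem retractClosure_iff_prop_biprod_shift (X : C) :
    A.retractClosure X ↔ A (X ⊞ X⟦(1 : ℤ)⟧) := by
  constructor
  · rintro ⟨Y, hY, ⟨e⟩⟩
    exact prop_biprod_shift_of_retract A e hY
  · exact fun h => ⟨_, h, ⟨{ i := biprod.inl, r := biprod.fst }⟩⟩

end RetractClosure

section Acat
variable {R : Type u} [CommRing R] {G : Type v} [Group G] [Finite G] [IsNoetherianRing R]
  [HasDerivedCategory.{w} (FGRep R G)]

/-- The image in the derived category of a bounded complex of permutation modules. -/
def UpsilonQuotientObjIso (K : CochainComplex (Perm R G) ℤ) (hK : boundedComplex _ K) :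
    ((UpsilonQuotient R G).obj ((Kbac R G).trW.Q.obj (Kb.mk K hK))).obj ≅
      DerivedCategory.Q.obj ((permIncl R G).obj K) :=
  (DerivedCategory.Bounded.ι (C := FGRep R G)).mapIso (QCompUpsilonQuotientIso.app (Kb.mk K hK)) ≪≫
    (DerivedCategory.quotientCompQhIso (FGRep R G)).app ((permIncl R G).obj K)

/-- `A(G;R)` is the essential image of the Verdier quotient, because every bounded complex of permutation
modules admits `m`-free permutation resolutions for all `m`. -/
theorem Acat_eq_essImage : Acat R G = (UpsilonQuotient R G).essImage := by
  ext X
  constructor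
  · rintro ⟨K, hK, ⟨e⟩, h⟩
    obtain ⟨P, hP, hP', -, s, hs⟩ := h 0
    have : IsIso (DerivedCategory.Q.map s) := by
      rwa [DerivedCategory.isIso_Q_map_iff_quasiIso]
    let e' : DerivedCategory.Q.obj P ≅ DerivedCategory.Q.obj K := asIso (DerivedCategory.Q.map s)
    refine ⟨(Kbac R G).trW.Q.obj (Kb.mk (permLift P hP') (boundedComplex_of_permIncl hP)),
      ⟨ObjectProperty.isoMk _ (UpsilonQuotientObjIso _ _ ≪≫ e' ≪≫ e)⟩⟩
  · rintro ⟨Z, ⟨e⟩⟩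
    obtain ⟨Z, rfl⟩ := VerdierQuotient.exists_eq_Q_obj Z
    obtain ⟨K, hK, rfl⟩ := Z.exists_eq_mk
    refine ⟨(permIncl R G).obj K, boundedComplex_permIncl hK,
      ⟨(UpsilonQuotientObjIso K hK).symm ≪≫
        (DerivedCategory.Bounded.ι (C := FGRep R G)).mapIso e⟩, fun m => ?_⟩
    obtain ⟨L, ψ, hψ, h₁, h₂, h₃⟩ := exists_quasiIso_freePermProp_of_le ((permIncl R G).obj K)
      (boundedComplex_permIncl hK) (fun j => (K.X j).property) (-m)
    exact ⟨L, h₁, h₂, fun j hj => (h₃ j hj).free, ψ, hψ⟩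

instance : (Acat R G).IsClosedUnderIsomorphisms := by
  rw [Acat_eq_essImage]
  infer_instance

instance : (Acat R G).IsTriangulated := by
  rw [Acat_eq_essImage]
  infer_instance

theorem AcatNat_eq_retractClosure : AcatNat R G = (Acat R G).retractClosure := by
  ext X
  exact (retractClosure_iff_prop_biprod_shift (Acat R G) X).symm

end Acat

/-! ### Distinguished triangles and the idempotent completion -/

section RetractTriangle
variable {C : Type*} [Category C] [Preadditive C] [HasZeroObject C] [HasShift C ℤ]
  [∀ n : ℤ, (shiftFunctor C n).Additive] [Pretriangulated C]

/-- A direct summand `T` of a distinguished triangle is distinguished: it inherits the exactness of the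
represented sequences, which suffices to show that the cone of its first morphism is isomorphic to
`T.obj₃`. -/
theorem distinguished_of_retract {T T' : Triangle C} (e : Retract T T') (hT' : T' ∈ distTriang C) :
    T ∈ distTriang C := by
  have e₁ : e.i.hom₁ ≫ e.r.hom₁ = 𝟙 _ := congr($(e.retract).hom₁)
  have e₂ : e.i.hom₂ ≫ e.r.hom₂ = 𝟙 _ := congr($(e.retract).hom₂)
  have e₃ : e.i.hom₃ ≫ e.r.hom₃ = 𝟙 _ := congr($(e.retract).hom₃)
  have ex₂ {U : C} (x : U ⟶ T.obj₂) (hx : x ≫ T.mor₂ = 0) : ∃ y, x = y ≫ T.mor₁ := by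
    obtain ⟨y, hy⟩ := Triangle.coyoneda_exact₂ _ hT' (x ≫ e.i.hom₂) (by
      rw [assoc, ← e.i.comm₂, reassoc_of% hx, zero_comp])
    refine ⟨y ≫ e.r.hom₁, ?_⟩
    rw [assoc, ← e.r.comm₁, ← reassoc_of% hy, e₂, comp_id]
  have ex₃ {U : C} (x : U ⟶ T.obj₃) (hx : x ≫ T.mor₃ = 0) : ∃ y, x = y ≫ T.mor₂ := by
    obtain ⟨y, hy⟩ := Triangle.coyoneda_exact₃ _ hT' (x ≫ e.i.hom₃) (by
      rw [assoc, ← e.i.comm₃, reassoc_of% hx, zero_comp])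
    refine ⟨y ≫ e.r.hom₂, ?_⟩
    rw [assoc, ← e.r.comm₂, ← reassoc_of% hy, e₃, comp_id]
  have h₃₁ : T.mor₃ ≫ T.mor₁⟦1⟧' = 0 := by
    have h : T.mor₃ ≫ T.mor₁⟦1⟧' ≫ e.i.hom₂⟦1⟧' = 0 := by
      rw [← Functor.map_comp, e.i.comm₁, Functor.map_comp, reassoc_of% e.i.comm₃,
        comp_distTriang_mor_zero₃₁ _ hT', comp_zero]
    have := congr($h ≫ e.r.hom₂⟦1⟧')
    rwa [zero_comp, assoc, assoc, ← Functor.map_comp, e₂, CategoryTheory.Functor.map_id, comp_id] at this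
  -- The comparison map from the cone `Z` to `T.obj₃` goes through the distinguished triangle.
  obtain ⟨Z, g, h, hS⟩ := distinguished_cocone_triangle T.mor₁
  obtain ⟨c, hc₁, hc₂⟩ : ∃ c : Z ⟶ T'.obj₃, g ≫ c = e.i.hom₂ ≫ T'.mor₂ ∧ h ≫ e.i.hom₁⟦1⟧' = c ≫ T'.mor₃ :=
    complete_distinguished_triangle_morphism _ _ hS hT' e.i.hom₁ e.i.hom₂ e.i.comm₁
  have hγ₁ : g ≫ c ≫ e.r.hom₃ = T.mor₂ := by
    rw [reassoc_of% hc₁, e.r.comm₂, reassoc_of% e₂]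
  have hγ₂ : (c ≫ e.r.hom₃) ≫ T.mor₃ = h := by
    rw [assoc, ← e.r.comm₃, ← reassoc_of% hc₂, ← Functor.map_comp, e₁,
      CategoryTheory.Functor.map_id, comp_id]
  have : Mono (c ≫ e.r.hom₃) := by
    rw [Preadditive.mono_iff_cancel_zero]
    intro U k hk
    obtain ⟨l, hl⟩ : ∃ l, k = l ≫ g := Triangle.coyoneda_exact₃ _ hS k (by
      change k ≫ h = 0
      rw [← hγ₂, ← assoc, hk, zero_comp])
    obtain ⟨m, hm⟩ := ex₂ l (by rw [← hγ₁, ← reassoc_of% hl, hk])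
    have : T.mor₁ ≫ g = 0 := comp_distTriang_mor_zero₁₂ _ hS
    rw [hl, hm, assoc, this, comp_zero]
  obtain ⟨s, hs⟩ : ∃ s, T.mor₃ = s ≫ h := Triangle.coyoneda_exact₁ _ hS T.mor₃ h₃₁
  obtain ⟨t, ht⟩ := ex₃ (𝟙 _ - s ≫ c ≫ e.r.hom₃) (by
    rw [Preadditive.sub_comp, id_comp, assoc, hγ₂, ← hs, sub_self])
  have : IsSplitEpi (c ≫ e.r.hom₃) := ⟨⟨⟨s + t ≫ g, by
    rw [Preadditive.add_comp, assoc t, hγ₁, ← ht, add_sub_cancel]⟩⟩⟩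
  have : IsIso (c ≫ e.r.hom₃) := isIso_of_mono_of_isSplitEpi _
  let γ : Z ≅ T.obj₃ := asIso (c ≫ e.r.hom₃)
  refine isomorphic_distinguished _ hS _ (Triangle.isoMk (Triangle.mk T.mor₁ g h) T (Iso.refl _)
    (Iso.refl _) γ ((comp_id _).trans (id_comp _).symm) (hγ₁.trans (id_comp _).symm) ?_).symm
  change h ≫ (𝟙 T.obj₁)⟦1⟧' = (c ≫ e.r.hom₃) ≫ T.mor₃
  rw [CategoryTheory.Functor.map_id, comp_id, hγ₂]

end RetractTriangle

section KaroubiExtension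
open Idempotents
variable {C D : Type*} [Category C] [Category D] {F : C ⥤ D} {F' : Karoubi C ⥤ D}

/-- Morphisms in the idempotent completion are compressions of morphisms between the underlying objects;
so an extension of a faithful functor is faithful. -/
theorem Karoubi.faithful_of_toKaroubi_comp (e : toKaroubi C ⋙ F' ≅ F) [F.Faithful] : F'.Faithful where
  map_injective {P Q} f g h := by
    have : (toKaroubi C ⋙ F').Faithful := Functor.Faithful.of_iso e.symm
    have h' : f.f = g.f := (toKaroubi C ⋙ F').map_injective (by
      have h₁ (f : P ⟶ Q) : (toKaroubi C).map f.f = P.decompId_p ≫ f ≫ Q.decompId_i := by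
        ext
        simp
      rw [Functor.comp_map, Functor.comp_map, h₁, h₁, Functor.map_comp, Functor.map_comp,
        Functor.map_comp, Functor.map_comp, h])
    exact (Karoubi.hom_ext_iff).2 h'

theorem Karoubi.full_of_toKaroubi_comp (e : toKaroubi C ⋙ F' ≅ F) [F.Full] : F'.Full where
  map_surjective {P Q} φ := by
    have : (toKaroubi C ⋙ F').Full := Functor.Full.of_iso e.symm
    obtain ⟨g, hg⟩ := (toKaroubi C ⋙ F').map_surjective
      (F'.map P.decompId_p ≫ φ ≫ F'.map Q.decompId_i)
    refine ⟨P.decompId_i ≫ (toKaroubi C).map g ≫ Q.decompId_p, ?_⟩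
    rw [Functor.comp_map] at hg
    rw [Functor.map_comp, Functor.map_comp, hg, assoc, assoc, ← Functor.map_comp, ← Functor.map_comp_assoc,
      ← Karoubi.decompId, ← Karoubi.decompId]
    simp

/-- The essential image of the extension of a fully faithful functor to the idempotent completion consists
of the direct summands of the objects in the essential image. -/
theorem Karoubi.essImage_eq_retractClosure (e : toKaroubi C ⋙ F' ≅ F) [F.Full] [F.Faithful] :
    F'.essImage = F.essImage.retractClosure := by
  ext X
  constructor
  · rintro ⟨P, ⟨f⟩⟩
    exact ⟨_, F.obj_mem_essImage P.X, ⟨f.symm.retract.trans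
      ((P.retract.map F').trans (e.app P.X).retract)⟩⟩
  · rintro ⟨Y, ⟨Z, ⟨f⟩⟩, ⟨r⟩⟩
    obtain ⟨p, hp⟩ := F.map_surjective (f.hom ≫ r.r ≫ r.i ≫ f.inv)
    have hp' : p ≫ p = p := F.map_injective (by
      rw [Functor.map_comp, hp]
      simp)
    -- The idempotent `p` of `Z` corresponds to the direct summand `X`.
    let P : Karoubi C := ⟨Z, p, hp'⟩
    have h₁ : P.decompId_p ≫ P.decompId_i = (toKaroubi C).map p := by
      ext
      exact hp'
    have h₂ : P.decompId_i ≫ (toKaroubi C).map p ≫ P.decompId_p = 𝟙 P := by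
      rw [← h₁, assoc, ← Karoubi.decompId_assoc, ← Karoubi.decompId]
    have h₃ : F'.map ((toKaroubi C).map p) = e.hom.app Z ≫ f.hom ≫ r.r ≫ r.i ≫ f.inv ≫ e.inv.app Z := by
      have := e.hom.naturality p
      rw [Functor.comp_map] at this
      rw [← cancel_mono (e.hom.app Z), this, hp]
      simp
    refine ⟨P, ⟨{
      hom := F'.map P.decompId_i ≫ e.hom.app Z ≫ f.hom ≫ r.r
      inv := r.i ≫ f.inv ≫ e.inv.app Z ≫ F'.map P.decompId_p
      hom_inv_id := ?_
      inv_hom_id := ?_ }⟩⟩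
    · rw [← CategoryTheory.Functor.map_id, ← h₂, Functor.map_comp, Functor.map_comp, h₃]
      simp only [assoc]
    · simp only [assoc]
      rw [← Functor.map_comp_assoc, h₁, h₃]
      simp

variable [HasShift C ℤ] [HasShift D ℤ] [F.CommShift ℤ]

/-- The isomorphism along which the commutation of `F'` with the shift is defined is itself compatible
with the shifts. -/
theorem extensionCommShift_compatible (e : toKaroubi C ⋙ F' ≅ F) :
    let _ := extensionCommShift (toKaroubi C) F F' e
    NatTrans.CommShift e.hom ℤ := by
  intro
  constructor
  intro a
  ext X
  have h₁ := extensionShiftIso_hom_app (toKaroubi C) F F' e a X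
  have h₂ := F'.map_comp (((toKaroubi C).commShiftIso a).hom.app X)
    (((toKaroubi C).commShiftIso a).inv.app X)
  rw [Iso.hom_inv_id_app, CategoryTheory.Functor.map_id] at h₂
  have h₃ : (e.inv.app X)⟦a⟧' ≫ (e.hom.app X)⟦a⟧' = 𝟙 _ := by
    rw [← Functor.map_comp, e.inv_hom_id_app, CategoryTheory.Functor.map_id]
  simp only [NatTrans.comp_app, Functor.commShiftIso_comp_hom_app, assoc, Functor.whiskerRight_app,
    Functor.whiskerLeft_app]
  refine (congrArg (fun t => F'.map _ ≫ t ≫ (e.hom.app X)⟦a⟧') h₁).trans ?_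
  rw [assoc, assoc, assoc, h₃]
  erw [comp_id, ← reassoc_of% h₂]

end KaroubiExtension

end

theorem mainTheorem2 (R : Type u) [CommRing R] [IsNoetherianRing R] (G : Type v) [Group G] [Finite G]
    [HasDerivedCategory.{w} (FGRep R G)] :
    (UpsilonBar R G).Full ∧ (UpsilonBar R G).Faithful ∧
    (UpsilonBar R G).essImage = AcatNat R G ∧
    (AcatNat R G).IsTriangulated ∧
    AcatNat R G = (Acat R G).retractClosure ∧
    ∀ T ∈ karoubiDistTriang (VerdierQuotient R G),
      (UpsilonBar R G).mapTriangle.obj T ∈ distTriang (Db R G) := by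
  let e := toKaroubiCompUpsilonBarIso R G
  refine ⟨Karoubi.full_of_toKaroubi_comp e, Karoubi.faithful_of_toKaroubi_comp e, ?_, ?_,
    AcatNat_eq_retractClosure, ?_⟩
  · rw [Karoubi.essImage_eq_retractClosure e, AcatNat_eq_retractClosure, Acat_eq_essImage]
  · rw [AcatNat_eq_retractClosure]
    infer_instance
  · rintro T ⟨T', hT', ⟨r⟩⟩
    have : NatTrans.CommShift e.hom ℤ := extensionCommShift_compatible e
    refine distinguished_of_retract ((r.map (UpsilonBar R G).mapTriangle).trans (Iso.retract ?_))
      ((UpsilonQuotient R G).map_distinguished _ hT')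
    exact ((Functor.mapTriangleCompIso (Idempotents.toKaroubi (VerdierQuotient R G))
      (UpsilonBar R G)).app T').symm ≪≫ (Functor.mapTriangleIso e).app T'
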